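/- **Setting.** Terms are built from a signature of function symbols with arities and a countably infinite set of variables; $|t|$ is the number of occurrences of symbols and variables in $t$. A TRS $\mathcal R$ is a finite set of rules $l\to r$ with $l$ not a variable and $\mathrm{Var}(r)\subseteq\mathrm{Var}(l)$; $\to_{\mathcal R}$ is the induced rewrite relation. For a terminating $\mathcal R$, its derivational complexity is $$\mathrm{dc}_{\mathcal R}(n)=\max\{\,m \mid \exists\, t,u:\ |t|\le n,\ t\to_{\mathcal R}^m u\,\}\qquad(\max\varnothing=0).$$ *Dependency pairs.* $\mathsf{DP}(\mathcal R)$ is the set of all $l^\sharp\to u^\sharp$ with $l\to r\in\mathcal R$, $u$ a subterm of $r$ but not a proper subterm of $l$, and the root of $u$ a defined symbol (the root of a left-hand side); here $f(\vec t)^\sharp=f^\sharp(\vec t)$ for a fresh symbol $f^\sharp$. A DP problem is a pair $(\mathcal P,\mathcal R)$ with $\mathcal P\subseteq\mathsf{DP}(\mathcal R)$. It is finite if there are no infinite sequences of pairs $s_i\to t_i\in\mathcal P$ and substitutions $\sigma_i$ such that every $t_i\sigma_i$ is terminating with respect to $\mathcal R$ and $t_i\sigma_i\to^*_{\mathcal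 R}s_{i+1}\sigma_{i+1}$. A DP processor maps each DP problem to a set of DP problems; it is sound if a DP problem is finite whenever all problems in its image are. The basic processors are the following, where $\mathcal P'\subseteq\mathcal P$ is a chosen subset. - *Reduction pair processor*, for a reduction pair $(\succcurlyeq,\succ)$ ($\succcurlyeq$ a preorder closed under contexts and substitutions, $\succ$ a well-founded order closed under substitutions, ${\succcurlyeq\cdot\succ\cdot\succcurlyeq}\subseteq{\succ}$): $(\mathcal P,\mathcal R)\mapsto\{(\mathcal P',\mathcal R)\}$ if $\mathcal P'\cup\mathcal R\subseteq{\succcurlyeq}$ and $\mathcal P\setminus\mathcal P'\subseteq{\succ}$, and $\{(\mathcal P,\mathcal R)\}$ otherwise. - *Dependency graph processor*: $(\mathcal P,\mathcal R)\mapsto\{(\mathcal P',\mathcal R)\mid \mathcal P'$ a nontrivial strongly connected component of the dependency graph$\}$; the graph has nodes $\mathcal P$ and an edge from $s\to t$ to $u\to v$ iff $t\sigma\to_{\mathcal R}^*u\tau$ for some $\sigma,\tau$; a component is trivial if it is a single node without a nonempty path to itself. - *Subterm criterion processor*, for a simple projection $\pi$ (which replaces $f^\sharp(t_1,\dots,t_n)$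 by one fixed argument $t_{\pi(f^\sharp)}$): $(\mathcal P,\mathcal R)\mapsto\{(\mathcal P',\mathcal R)\}$ if $\pi(s)\trianglerighteq\pi(t)$ for all $s\to t\in\mathcal P'$ and $\pi(s)\rhd\pi(t)$ for all $s\to t\in\mathcal P\setminus\mathcal P'$, and $\{(\mathcal P,\mathcal R)\}$ otherwise, with $\rhd$ the proper superterm relation. A *basic proof tree* of $\mathcal R$ is a finite tree of DP problems with root $(\mathsf{DP}(\mathcal R),\mathcal R)$ in which every node is either a leaf $(\varnothing,\mathcal R)$ or has as children exactly the elements of its image under some sound basic processor. A TRS with a basic proof tree is terminating. *Multiply recursive functions.* For $k\ge2$ the $k$-ary Ackermann function $A_k:\mathbb N^k\to\mathbb N$ is the unique function satisfying $$\begin{aligned}A_k(0,\dots,0,n)&=n+1,\\ A_k(x_1,\dots,x_{k-2},m+1,0)&=A_k(x_1,\dots,x_{k-2},m,1),\\ A_k(x_1,\dots,x_{k-2},m+1,n+1)&=A_k(x_1,\dots,x_{k-2},m,A_k(x_1,\dots,x_{k-2},m+1,n)),\\ A_k(x_1,\dots,x_{i-1},x_i+1,0,\dots,0,n)&=A_k(x_1,\dots,x_i,n,0,\dots,0,n)\quad(1\le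 i\le k-2).\end{aligned}$$ The multiply recursive functions form the least class of functions $\mathbb N^m\to\mathbb N$ ($m\ge0$) that contains all constant zero functions, the successor, all projections and all $A_k$, and is closed under composition and primitive recursion. *The systems $\mathcal R_k$.* For $k\ge2$ let $\mathcal R_k$ be the TRS over $\mathsf 0$ (arity $0$), $\mathsf s$ (arity $1$) and $\mathsf{Ack}_k$ (arity $k$) with the rules $$\begin{aligned}\mathsf{Ack}_k(\mathsf 0,\dots,\mathsf 0,n)&\to\mathsf s(n),\\ \mathsf{Ack}_k(l_1,\dots,l_{k-2},\mathsf s(m),\mathsf 0)&\to\mathsf{Ack}_k(l_1,\dots,l_{k-2},m,\mathsf s(\mathsf 0)),\\ \mathsf{Ack}_k(l_1,\dots,l_{k-2},\mathsf s(m),\mathsf s(n))&\to\mathsf{Ack}_k(l_1,\dots,l_{k-2},m,\mathsf{Ack}_k(l_1,\dots,l_{k-2},\mathsf s(m),n)),\\ \mathsf{Ack}_k(l_1,\dots,l_{i-1},\mathsf s(l_i),\mathsf 0,\dots,\mathsf 0,n)&\to\mathsf{Ack}_k(l_1,\dots,l_i,n,\mathsf 0,\dots,\mathsf 0,n)\quad(1\le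 i\le k-2).\end{aligned}$$ **Lemma.** For every multiply recursive function $f:\mathbb N^m\to\mathbb N$ there is a TRS $\mathcal R$ whose derivational complexity majorises $f$ and whose termination is shown by a basic proof tree. More precisely, there is a $k\ge2$ such that, for $\mathcal R=\mathcal R_k$: 1. there is an $N$ such that $f(x_1,\dots,x_m)<\mathrm{dc}_{\mathcal R}(\max(x_1,\dots,x_m))$ for all $(x_1,\dots,x_m)\in\mathbb N^m$ with $\max(x_1,\dots,x_m)\ge N$ (where $\max$ of the empty tuple is $0$); 2. $\mathcal R$ is terminating, and $\mathrm{dc}_{\mathcal R}(n)$ is finite for all $n$; 3. $\mathcal R$ has a basic proof tree; 4. $k$ successive applications of subterm criterion processors, each removing at least one pair, transform $(\mathsf{DP}(\mathcal R),\mathcal R)$ into $(\varnothing,\mathcal R)$. -/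

import Mathlib

namespace DPFramework

/-! ### Terms and term rewriting

A signature is (the function part of) a first-order language `L`, and the terms over `L` and the
countably infinite set of variables `ℕ` are Mathlib's `L.Term ℕ`. -/

/-- Terms over the signature `L` with variables from `ℕ`. -/
abbrev Tm (L : FirstOrder.Language.{0, 0}) := L.Term ℕ

/-- The size of a term: the number of occurrences of variables and function symbols. -/
def size {L : FirstOrder.Language.{0, 0}} : Tm L → ℕ
  | .var _ => 1
  | .func _ ts => 1 + ∑ i, size (ts i)

/-- `Subterm u t`: the term `u` is a (not necessarily proper) subterm of `t`. -/
inductive Subterm {L : FirstOrder.Language.{0, 0}} : Tm L → Tm L → Prop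
  | refl (t : Tm L) : Subterm t t
  | arg {n : ℕ} (f : L.Functions n) (ts : Fin n → Tm L) (i : Fin n) {u : Tm L} :
      Subterm u (ts i) → Subterm u (.func f ts)

/-- `ProperSubterm u t`: the term `u` is a proper subterm of `t`. -/
def ProperSubterm {L : FirstOrder.Language.{0, 0}} (u t : Tm L) : Prop := Subterm u t ∧ u ≠ t

/-- A pair of terms, written `lhs → rhs`. -/
structure Rule (L : FirstOrder.Language.{0, 0}) where
  lhs : Tm L
  rhs : Tm L

/-- A finite term rewrite system over the signature `L`. -/
structure TRS (L : FirstOrder.Language.{0, 0}) where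
  rules : Set (Rule L)
  finite : rules.Finite
  lhs_ne_var : ∀ ρ ∈ rules, ∀ x : ℕ, ρ.lhs ≠ .var x
  vars_subset : ∀ ρ ∈ rules, ρ.rhs.varFinset ⊆ ρ.lhs.varFinset

/-- The one-step rewrite relation induced by a set of rules: the closure of the rules under
substitutions and contexts. -/
inductive Step {L : FirstOrder.Language.{0, 0}} (S : Set (Rule L)) : Tm L → Tm L → Prop
  | root (ρ : Rule L) (hρ : ρ ∈ S) (σ : ℕ → Tm L) : Step S (ρ.lhs.subst σ) (ρ.rhs.subst σ)
  | arg {n : ℕ} (f : L.Functions n) (ts : Fin n → Tm L) (i : Fin n) (u : Tm L) :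
      Step S (ts i) u → Step S (.func f ts) (.func f (Function.update ts i u))

/-- `t` is terminating: no infinite rewrite sequence starts in `t`. -/
def TerminatingAt {L : FirstOrder.Language.{0, 0}} (S : Set (Rule L)) (t : Tm L) : Prop :=
  ¬ ∃ s : ℕ → Tm L, s 0 = t ∧ ∀ i, Step S (s i) (s (i + 1))

/-- A TRS is terminating if it admits no infinite rewrite sequence. -/
def TRS.Terminating {L : FirstOrder.Language.{0, 0}} (R : TRS L) : Prop :=
  ∀ t : Tm L, TerminatingAt R.rules t

/-- The `n`-fold composition of a relation. -/
def nfold {α : Type} (r : α → α → Prop) : ℕ → α → α → Prop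
  | 0 => fun a b => a = b
  | n + 1 => fun a c => ∃ b, r a b ∧ nfold r n b c

/-- The derivation height of `s`: the supremum of all `n` with `s →ⁿ t` for some `t`. It is
formed in `ℕ∞`, where the value `⊤` signals that no maximum exists. -/
noncomputable def derivationHeight {L : FirstOrder.Language.{0, 0}} (r : Tm L → Tm L → Prop) (s : Tm L) : ℕ∞ :=
  ⨆ n : ℕ, ⨆ _ : ∃ t, nfold r n s t, (n : ℕ∞)

/-- The derivational complexity function: `n ↦ max {dheight t | size t ≤ n}`, formed in `ℕ∞`. -/
noncomputable def TRS.derivationalComplexity {L : FirstOrder.Language.{0, 0}} (R : TRS L) (n : ℕ) : ℕ∞ :=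
  ⨆ t : Tm L, ⨆ _ : size t ≤ n, derivationHeight (Step R.rules) t

/-! ### Dependency pairs

In `L.sum L` the left copy consists of the original symbols `f`, and the right copy of the
dependency pair symbols `f♯`. -/

/-- A term over `L` read as a term over the signature extended by dependency pair symbols. -/
def plain {L : FirstOrder.Language.{0, 0}} (t : Tm L) : Tm (L.sum L) :=
  (FirstOrder.Language.LHom.sumInl (L := L) (L' := L)).onTerm t

/-- `t♯`: the root symbol of `t` (if `t` is not a variable) is replaced by its dependency pair
symbol. -/
def sharp {L : FirstOrder.Language.{0, 0}} : Tm L → Tm (L.sum L)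
  | .var x => .var x
  | .func f ts => .func (Sum.inr f) (fun i => plain (ts i))

/-- The rules of `R`, read over the extended signature. -/
def TRS.plainRules {L : FirstOrder.Language.{0, 0}} (R : TRS L) : Set (Rule (L.sum L)) :=
  (fun ρ => ⟨plain ρ.lhs, plain ρ.rhs⟩) '' R.rules

/-- `f` is a defined symbol of `R`: the root of some left-hand side. -/
def TRS.IsDefined {L : FirstOrder.Language.{0, 0}} (R : TRS L) {n : ℕ} (f : L.Functions n) : Prop :=
  ∃ ρ ∈ R.rules, ∃ ts : Fin n → Tm L, ρ.lhs = .func f ts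

/-- The dependency pairs `l♯ → u♯` of `R`, where `l → r` is a rule, `u` is a subterm of `r` with a
defined root symbol, and `u` is not a proper subterm of `l`. -/
def TRS.dependencyPairs {L : FirstOrder.Language.{0, 0}} (R : TRS L) : Set (Rule (L.sum L)) :=
  {p | ∃ ρ ∈ R.rules, ∃ (n : ℕ) (f : L.Functions n) (ts : Fin n → Tm L),
    R.IsDefined f ∧ Subterm (.func f ts) ρ.rhs ∧ ¬ ProperSubterm (.func f ts) ρ.lhs ∧
      p = ⟨sharp ρ.lhs, sharp (.func f ts)⟩}

/-- A DP problem `(P, R)`, with `P` a set of dependency pairs of `R`. -/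
structure DPProblem (L : FirstOrder.Language.{0, 0}) where
  pairs : Set (Rule (L.sum L))
  trs : TRS L
  pairs_subset : pairs ⊆ trs.dependencyPairs

/-- The DP problem `(DP(R), R)`. -/
def TRS.initialProblem {L : FirstOrder.Language.{0, 0}} (R : TRS L) : DPProblem L :=
  ⟨R.dependencyPairs, R, subset_rfl⟩

/-- The rewrite relation of `R` on terms over the extended signature. -/
def DPProblem.Rew {L : FirstOrder.Language.{0, 0}} (p : DPProblem L) : Tm (L.sum L) → Tm (L.sum L) → Prop :=
  Step p.trs.plainRules

/-- A DP problem is finite if there is no infinite sequence of pairs `sᵢ → tᵢ` in `P` and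
substitutions `σᵢ` such that each `tᵢσᵢ` is terminating with respect to `R`, and `tᵢσᵢ` rewrites
to `sᵢ₊₁σᵢ₊₁` in `R`. -/
def DPProblem.IsFinite {L : FirstOrder.Language.{0, 0}} (p : DPProblem L) : Prop :=
  ¬ ∃ (ρ : ℕ → Rule (L.sum L)) (σ : ℕ → ℕ → Tm (L.sum L)), ∀ i,
    ρ i ∈ p.pairs ∧ TerminatingAt p.trs.plainRules ((ρ i).rhs.subst (σ i)) ∧
      Relation.ReflTransGen p.Rew ((ρ i).rhs.subst (σ i)) ((ρ (i + 1)).lhs.subst (σ (i + 1)))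

/-- A DP processor maps DP problems to sets of DP problems. -/
abbrev Processor (L : FirstOrder.Language.{0, 0}) := DPProblem L → Set (DPProblem L)

/-- A DP processor is sound if a DP problem is finite whenever all DP problems it is mapped to
are. -/
def Processor.Sound {L : FirstOrder.Language.{0, 0}} (Φ : Processor L) : Prop :=
  ∀ p : DPProblem L, (∀ q ∈ Φ p, q.IsFinite) → p.IsFinite

/-- A reduction pair on terms over the signature `L`. -/
structure ReductionPair (L : FirstOrder.Language.{0, 0}) where
  geq : Tm L → Tm L → Prop
  gt : Tm L → Tm L → Prop
  geq_refl : ∀ s, geq s s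
  geq_trans : ∀ s t u, geq s t → geq t u → geq s u
  geq_subst : ∀ s t (σ : ℕ → Tm L), geq s t → geq (s.subst σ) (t.subst σ)
  geq_context : ∀ (n : ℕ) (f : L.Functions n) (ts : Fin n → Tm L) (i : Fin n) (u : Tm L),
    geq (ts i) u → geq (.func f ts) (.func f (Function.update ts i u))
  gt_trans : ∀ s t u, gt s t → gt t u → gt s u
  gt_wf : WellFounded (fun s t => gt t s)
  gt_subst : ∀ s t (σ : ℕ → Tm L), gt s t → gt (s.subst σ) (t.subst σ)
  compatible : ∀ s t u v, geq s t → gt t u → geq u v → gt s v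

open Classical in
/-- The reduction pair processor `(P, R) ↦ {(P', R)}` if `P' ∪ R ⊆ ≽` and `P \ P' ⊆ ≻`, and
`(P, R) ↦ {(P, R)}` otherwise. The function `P'` selects the subset `P'` of `P`. -/
noncomputable def reductionPairProcessor {L : FirstOrder.Language.{0, 0}} (o : ReductionPair (L.sum L))
    (P' : DPProblem L → Set (Rule (L.sum L))) : Processor L := fun p =>
  if h : P' p ⊆ p.pairs ∧ (∀ ρ ∈ P' p ∪ p.trs.plainRules, o.geq ρ.lhs ρ.rhs) ∧
      ∀ ρ ∈ p.pairs \ P' p, o.gt ρ.lhs ρ.rhs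
  then {⟨P' p, p.trs, h.1.trans p.pairs_subset⟩}
  else {p}

/-- The edges of the dependency graph, whose nodes are the elements of `P`. -/
def DPProblem.Edge {L : FirstOrder.Language.{0, 0}} (p : DPProblem L) (ρ ρ' : Rule (L.sum L)) : Prop :=
  ρ ∈ p.pairs ∧ ρ' ∈ p.pairs ∧ ∃ σ τ : ℕ → Tm (L.sum L),
    Relation.ReflTransGen p.Rew (ρ.rhs.subst σ) (ρ'.lhs.subst τ)

/-- A strongly connected component: a (nonempty) maximal set of nodes that are pairwise connected
by (possibly empty) paths. -/
def DPProblem.IsSCC {L : FirstOrder.Language.{0, 0}} (p : DPProblem L) (C : Set (Rule (L.sum L))) : Prop :=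
  C.Nonempty ∧
    Maximal (fun D => D ⊆ p.pairs ∧ ∀ a ∈ D, ∀ b ∈ D, Relation.ReflTransGen p.Edge a b) C

/-- A nontrivial strongly connected component: not a single node whose only path to itself is
empty. -/
def DPProblem.IsNontrivialSCC {L : FirstOrder.Language.{0, 0}} (p : DPProblem L)
    (C : Set (Rule (L.sum L))) : Prop :=
  p.IsSCC C ∧ ¬ ∃ a, C = {a} ∧ ¬ Relation.TransGen p.Edge a a

/-- The dependency graph processor. -/
def dependencyGraphProcessor {L : FirstOrder.Language.{0, 0}} : Processor L := fun p =>
  {q | q.trs = p.trs ∧ p.IsNontrivialSCC q.pairs}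

/-- A simple projection assigns one argument position to each dependency pair symbol (other than
constants, which have no argument). -/
abbrev SimpleProjection (L : FirstOrder.Language.{0, 0}) := ∀ n : ℕ, 0 < n → L.Functions n → Fin n

/-- The application of a simple projection to a term: ordinary symbols keep all their arguments,
and `f♯(t₁,…,tₙ)` is replaced by the argument that the projection selects. -/
def SimpleProjection.apply {L : FirstOrder.Language.{0, 0}} (π : SimpleProjection L) :
    Tm (L.sum L) → Tm (L.sum L)
  | .var x => .var x
  | .func (l := n) f ts =>
    match f with
    | Sum.inl g => .func (Sum.inl g) (fun i => π.apply (ts i))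
    | Sum.inr g => if h : 0 < n then π.apply (ts (π n h g)) else .func (Sum.inr g) ts

open Classical in
/-- The subterm criterion processor `(P, R) ↦ {(P', R)}` if `π(P') ⊆ ⊵` and `π(P \ P') ⊆ ▷`, and
`(P, R) ↦ {(P, R)}` otherwise. The function `P'` selects the subset `P'` of `P`. -/
noncomputable def subtermCriterionProcessor {L : FirstOrder.Language.{0, 0}} (π : SimpleProjection L)
    (P' : DPProblem L → Set (Rule (L.sum L))) : Processor L := fun p =>
  if h : P' p ⊆ p.pairs ∧ (∀ ρ ∈ P' p, Subterm (π.apply ρ.rhs) (π.apply ρ.lhs)) ∧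
      ∀ ρ ∈ p.pairs \ P' p, ProperSubterm (π.apply ρ.rhs) (π.apply ρ.lhs)
  then {⟨P' p, p.trs, h.1.trans p.pairs_subset⟩}
  else {p}

/-- `Φ` is a subterm criterion processor. -/
def IsSubtermCriterion {L : FirstOrder.Language.{0, 0}} (Φ : Processor L) : Prop :=
  ∃ π P', Φ = subtermCriterionProcessor π P'

/-- `Φ` is a reduction pair, dependency graph, or subterm criterion processor. -/
def IsBasicProcessor {L : FirstOrder.Language.{0, 0}} (Φ : Processor L) : Prop :=
  (∃ o P', Φ = reductionPairProcessor o P') ∨ Φ = dependencyGraphProcessor ∨ IsSubtermCriterion Φ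

/-- `HasProofTree A p`: there is a proof tree with root `p` all of whose edges are labelled by
sound DP processors that satisfy `A`. -/
inductive HasProofTree {L : FirstOrder.Language.{0, 0}} (A : Processor L → Prop) : DPProblem L → Prop
  | leaf (p : DPProblem L) : p.pairs = ∅ → HasProofTree A p
  | node (p : DPProblem L) (Φ : Processor L) : Φ.Sound → A Φ →
      (∀ q ∈ Φ p, HasProofTree A q) → HasProofTree A p

/-- The TRS `R` has a proof tree that only uses reduction pair, dependency graph, and subterm
criterion processors. -/
def TRS.HasBasicProofTree {L : FirstOrder.Language.{0, 0}} (R : TRS L) : Prop :=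
  HasProofTree IsBasicProcessor R.initialProblem

/-- `k` successive applications of subterm criterion processors, each of which removes at least one
pair, transform `(DP(R), R)` into `(∅, R)`. -/
def TRS.ProvedBySubtermCriterion {L : FirstOrder.Language.{0, 0}} (R : TRS L) (k : ℕ) : Prop :=
  ∃ p : ℕ → DPProblem L, p 0 = R.initialProblem ∧ (p k).pairs = ∅ ∧
    ∀ i < k, (p (i + 1)).pairs ⊂ (p i).pairs ∧ ∃ Φ, IsSubtermCriterion Φ ∧ Φ (p i) = {p (i + 1)}

/-! ### Multiply recursive functions

The Ackermann functions and their rewrite systems are indexed by `j`, and their arity is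
`k = j + 2`. The last argument position of `Fin (j + 2)` is `last j`, the one before is `pen j`,
and the remaining ones are `front i` with `i : Fin j`. -/

/-- The position of `x_k`. -/
abbrev last (j : ℕ) : Fin (j + 2) := Fin.last (j + 1)

/-- The position of `x_{k-1}`. -/
abbrev pen (j : ℕ) : Fin (j + 2) := (Fin.last j).castSucc

/-- The position of `x_i`, for `1 ≤ i ≤ k-2`. -/
abbrev front {j : ℕ} (i : Fin j) : Fin (j + 2) := i.castSucc.castSucc

/-- The position of `x_{i+1}`, for `1 ≤ i ≤ k-2`. -/
abbrev frontSucc {j : ℕ} (i : Fin j) : Fin (j + 2) := i.succ.castSucc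

open Function in
/-- The defining equations of the Ackermann function of arity `k = j + 2`. -/
structure IsAckermann (j : ℕ) (A : (Fin (j + 2) → ℕ) → ℕ) : Prop where
  /-- `A(0,…,0,x_k) = x_k + 1` -/
  base : ∀ x, (∀ i, i ≠ last j → x i = 0) → A x = x (last j) + 1
  /-- `A(x_1,…,x_{k-2},m+1,0) = A(x_1,…,x_{k-2},m,1)` -/
  zero : ∀ x m, x (pen j) = m + 1 → x (last j) = 0 →
    A x = A (update (update x (pen j) m) (last j) 1)
  /-- `A(x_1,…,x_{k-2},m+1,n+1) = A(x_1,…,x_{k-2},m,A(x_1,…,x_{k-2},m+1,n))` -/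
  succ : ∀ x m n, x (pen j) = m + 1 → x (last j) = n + 1 →
    A x = A (update (update x (pen j) m) (last j) (A (update x (last j) n)))
  /-- `A(x_1,…,x_{i-1},m+1,0,…,0,x_k) = A(x_1,…,x_{i-1},m,x_k,0,…,0,x_k)` -/
  front : ∀ x (i : Fin j) m, x (front i) = m + 1 →
    (∀ l, front i < l → l < last j → x l = 0) →
    A x = A (update (update x (front i) m) (frontSucc i) (x (last j)))

/-- The lexicographic order on argument tuples, along which the equations recurse. -/
def LexLT {j : ℕ} (x y : Fin (j + 2) → ℕ) : Prop := ∃ i, (∀ l, l < i → x l = y l) ∧ x i < y i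

theorem wellFounded_lexLT (j : ℕ) : WellFounded (LexLT (j := j)) :=
  Pi.Lex.wellFounded (· < ·) (fun _ => wellFounded_lt)

theorem front_lt_pen {j : ℕ} (i : Fin j) : front i < pen j := by
  simp [Fin.lt_def]

theorem pen_lt_last (j : ℕ) : pen j < last j := by
  simp [Fin.lt_def]

theorem front_lt_frontSucc {j : ℕ} (i : Fin j) : front i < frontSucc i := by
  simp [Fin.lt_def]

open Function in
theorem lexLT_update_pen {j : ℕ} {x : Fin (j + 2) → ℕ} {m : ℕ} (h : x (pen j) = m + 1) (v : ℕ) :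
    LexLT (update (update x (pen j) m) (last j) v) x := by
  refine ⟨pen j, fun l hl => ?_, ?_⟩
  · rw [update_of_ne (hl.trans (pen_lt_last j)).ne, update_of_ne hl.ne]
  · rw [update_of_ne (pen_lt_last j).ne, update_self]; omega

open Function in
theorem lexLT_update_last {j : ℕ} {x : Fin (j + 2) → ℕ} {n : ℕ} (h : x (last j) = n + 1) :
    LexLT (update x (last j) n) x := by
  refine ⟨last j, fun l hl => ?_, ?_⟩
  · rw [update_of_ne hl.ne]
  · rw [update_self]; omega

open Function in
theorem lexLT_update_front {j : ℕ} {x : Fin (j + 2) → ℕ} {i : Fin j} {m : ℕ}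
    (h : x (front i) = m + 1) (v : ℕ) :
    LexLT (update (update x (front i) m) (frontSucc i) v) x := by
  refine ⟨front i, fun l hl => ?_, ?_⟩
  · rw [update_of_ne (hl.trans (front_lt_frontSucc i)).ne, update_of_ne hl.ne]
  · rw [update_of_ne (front_lt_frontSucc i).ne, update_self]; omega

theorem ackermann_cases {j : ℕ} (x : Fin (j + 2) → ℕ) :
    (∀ i, i ≠ last j → x i = 0) ∨ (∃ m, x (pen j) = m + 1) ∨
      ∃ (i : Fin j) (m : ℕ), x (front i) = m + 1 ∧ ∀ l, front i < l → l < last j → x l = 0 := by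
  classical
  by_cases h : ∀ i, i ≠ last j → x i = 0
  · exact Or.inl h
  right
  push Not at h
  obtain ⟨i₀, hi₀, hx₀⟩ := h
  let s : Finset (Fin (j + 2)) := Finset.univ.filter fun i => i ≠ last j ∧ x i ≠ 0
  have hs : s.Nonempty := ⟨i₀, by simp [s, hi₀, hx₀]⟩
  have hmem := s.max'_mem hs
  have hmax : ∀ l, s.max' hs < l → l < last j → x l = 0 := by
    intro l hl hl'
    by_contra hne
    exact absurd (s.le_max' l (by simp [s, hl'.ne, hne])) (not_le.2 hl)
  generalize s.max' hs = i at hmem hmax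
  simp only [s, Finset.mem_filter, Finset.mem_univ, true_and] at hmem
  obtain ⟨m, hm⟩ := Nat.exists_eq_succ_of_ne_zero hmem.2
  by_cases hp : i = pen j
  · exact Or.inl ⟨m, by rw [← hp, hm]⟩
  · right
    have h1 : i.val ≠ j + 1 := fun h => hmem.1 (Fin.ext (by simp [h]))
    have h2 : i.val ≠ j := fun h => hp (Fin.ext (by simp [h]))
    have h3 : i.val < j := by have := i.isLt; omega
    exact ⟨⟨i.val, h3⟩, m, hm, hmax⟩

theorem front_unique {j : ℕ} {x : Fin (j + 2) → ℕ} {i i' : Fin j}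
    (h : x (front i) ≠ 0) (h0 : ∀ l, front i < l → l < last j → x l = 0)
    (h' : x (front i') ≠ 0) (h0' : ∀ l, front i' < l → l < last j → x l = 0) : i = i' := by
  rcases lt_trichotomy i i' with hlt | heq | hlt
  · exact absurd (h0 _ (by simpa using hlt) ((front_lt_pen i').trans (pen_lt_last j))) h'
  · exact heq
  · exact absurd (h0' _ (by simpa using hlt) ((front_lt_pen i).trans (pen_lt_last j))) h

open Function Classical in
/-- The recursion along `LexLT` that the defining equations describe. -/
noncomputable def ackermannRec (j : ℕ) : (Fin (j + 2) → ℕ) → ℕ :=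
  (wellFounded_lexLT j).fix fun x rec =>
    if hp : ∃ m, x (pen j) = m + 1 then
      if hl : ∃ n, x (last j) = n + 1 then
        rec _ (lexLT_update_pen hp.choose_spec (rec _ (lexLT_update_last hl.choose_spec)))
      else rec _ (lexLT_update_pen hp.choose_spec 1)
    else if hf : ∃ q : Fin j × ℕ, x (front q.1) = q.2 + 1 ∧
        ∀ l, front q.1 < l → l < last j → x l = 0 then
      rec _ (lexLT_update_front hf.choose_spec.1 (x (last j)))
    else x (last j) + 1

theorem isAckermann_ackermannRec (j : ℕ) : IsAckermann j (ackermannRec j) where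
  base x h := by
    rw [ackermannRec, WellFounded.fix_eq, dif_neg, dif_neg]
    · rintro ⟨q, hq, -⟩
      rw [h _ ((front_lt_pen q.1).trans (pen_lt_last j)).ne] at hq
      omega
    · rintro ⟨m, hm⟩
      rw [h _ (pen_lt_last j).ne] at hm
      omega
  zero x m hm hl := by
    have hp : ∃ m, x (pen j) = m + 1 := ⟨m, hm⟩
    have hc : hp.choose = m := by have := hp.choose_spec; omega
    rw [ackermannRec, WellFounded.fix_eq, dif_pos hp, dif_neg (by rintro ⟨n, hn⟩; omega)]
    beta_reduce
    rw [hc]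
  succ x m n hm hn := by
    have hp : ∃ m, x (pen j) = m + 1 := ⟨m, hm⟩
    have hc : hp.choose = m := by have := hp.choose_spec; omega
    have hl : ∃ n, x (last j) = n + 1 := ⟨n, hn⟩
    have hd : hl.choose = n := by have := hl.choose_spec; omega
    rw [ackermannRec, WellFounded.fix_eq, dif_pos hp, dif_pos hl]
    beta_reduce
    rw [hc, hd]
  front x i m hm h0 := by
    have hf : ∃ q : Fin j × ℕ, x (front q.1) = q.2 + 1 ∧
        ∀ l, front q.1 < l → l < last j → x l = 0 := ⟨(i, m), hm, h0⟩
    have hi : hf.choose.1 = i :=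
      front_unique (by rw [hf.choose_spec.1]; omega) hf.choose_spec.2 (by rw [hm]; omega) h0
    have hc : hf.choose.2 = m := by
      have := hf.choose_spec.1
      rw [hi] at this
      omega
    rw [ackermannRec, WellFounded.fix_eq, dif_neg, dif_pos hf]
    · beta_reduce
      rw [hi, hc]
    rintro ⟨n, hn⟩
    rw [h0 _ (front_lt_pen i) (pen_lt_last j)] at hn
    omega

theorem existsUnique_isAckermann (j : ℕ) : ∃! A, IsAckermann j A := by
  refine ⟨ackermannRec j, isAckermann_ackermannRec j, fun A hA => funext fun x => ?_⟩
  have hB := isAckermann_ackermannRec j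
  induction x using (wellFounded_lexLT j).induction with
  | _ x ih =>
    rcases ackermann_cases x with h | ⟨m, hm⟩ | ⟨i, m, hm, h0⟩
    · rw [hA.base x h, hB.base x h]
    · rcases hl : x (last j) with _ | n
      · rw [hA.zero x m hm hl, hB.zero x m hm hl, ih _ (lexLT_update_pen hm 1)]
      · rw [hA.succ x m n hm hl, hB.succ x m n hm hl, ih _ (lexLT_update_last hl),
          ih _ (lexLT_update_pen hm _)]
    · rw [hA.front x i m hm h0, hB.front x i m hm h0, ih _ (lexLT_update_front hm _)]

/-- The Ackermann function of arity `k = j + 2`. -/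
noncomputable def ackermann (j : ℕ) : (Fin (j + 2) → ℕ) → ℕ :=
  (existsUnique_isAckermann j).choose

theorem isAckermann_ackermann (j : ℕ) : IsAckermann j (ackermann j) :=
  (existsUnique_isAckermann j).choose_spec.1

/-- The multiply recursive functions: the smallest set of functions that contains the initial
functions and the Ackermann functions, and is closed under composition and primitive recursion. -/
inductive MultiplyRecursive : ∀ {n : ℕ}, ((Fin n → ℕ) → ℕ) → Prop
  | zero (n : ℕ) : MultiplyRecursive (fun _ : Fin n → ℕ => 0)
  | succ : MultiplyRecursive (fun x : Fin 1 → ℕ => x 0 + 1)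
  | proj {n : ℕ} (i : Fin n) : MultiplyRecursive (fun x : Fin n → ℕ => x i)
  | ack (j : ℕ) : MultiplyRecursive (ackermann j)
  | comp {m n : ℕ} (f : (Fin m → ℕ) → ℕ) (g : Fin m → (Fin n → ℕ) → ℕ) :
      MultiplyRecursive f → (∀ i, MultiplyRecursive (g i)) →
      MultiplyRecursive (fun x => f (fun i => g i x))
  | prec {n : ℕ} (f : (Fin n → ℕ) → ℕ) (g : (Fin (n + 2) → ℕ) → ℕ)
      (h : (Fin (n + 1) → ℕ) → ℕ) :
      MultiplyRecursive f → MultiplyRecursive g →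
      (∀ x, h (Fin.cons 0 x) = f x) →
      (∀ y x, h (Fin.cons (y + 1) x) = g (Fin.cons y (Fin.cons (h (Fin.cons y x)) x))) →
      MultiplyRecursive h

/-- `g` majorises `f` (asymptotically): with at most finitely many exceptions, `f(x₁,…,xₘ)` is
smaller than `g(max(x₁,…,xₘ))`. -/
def Majorises (g : ℕ → ℕ∞) {m : ℕ} (f : (Fin m → ℕ) → ℕ) : Prop :=
  ∃ N : ℕ, ∀ x : Fin m → ℕ, N ≤ Finset.univ.sup x → (f x : ℕ∞) < g (Finset.univ.sup x)

/-! ### The rewrite system of the Ackermann function of arity `k = j + 2` -/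

/-- The function symbols `0`, `s` and `Ack_k`, indexed by their arity. -/
inductive AckSymbol (j : ℕ) : ℕ → Type
  | zero : AckSymbol j 0
  | succ : AckSymbol j 1
  | ack : AckSymbol j (j + 2)

/-- The signature that consists of `0`, `s` and `Ack_k`. -/
def ackLang (j : ℕ) : FirstOrder.Language.{0, 0} := ⟨AckSymbol j, fun _ => Empty⟩

/-- The term `0`. -/
def tZero (j : ℕ) : Tm (ackLang j) := .func (L := ackLang j) AckSymbol.zero ![]

/-- The term `s(t)`. -/
def tSucc {j : ℕ} (t : Tm (ackLang j)) : Tm (ackLang j) :=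
  .func (L := ackLang j) AckSymbol.succ ![t]

/-- The term `Ack_k(t₁,…,t_k)`. -/
def tAck {j : ℕ} (ts : Fin (j + 2) → Tm (ackLang j)) : Tm (ackLang j) :=
  .func (L := ackLang j) AckSymbol.ack ts

/-- The variable that belongs to an argument position. -/
def tVar {j : ℕ} (i : Fin (j + 2)) : Tm (ackLang j) := .var i.val

theorem mem_vars_tSucc {j : ℕ} {t : Tm (ackLang j)} {v : ℕ} :
    v ∈ (tSucc t).varFinset ↔ v ∈ t.varFinset := by
  simp [tSucc, FirstOrder.Language.Term.varFinset]

theorem mem_vars_tAck {j : ℕ} {ts : Fin (j + 2) → Tm (ackLang j)} {v : ℕ} :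
    v ∈ (tAck ts).varFinset ↔ ∃ i, v ∈ (ts i).varFinset := by
  simp [tAck, FirstOrder.Language.Term.varFinset]

theorem not_mem_vars_tZero {j : ℕ} {v : ℕ} : v ∉ (tZero j).varFinset := by
  simp [tZero, FirstOrder.Language.Term.varFinset]

/-- `Ack(0,…,0,n) → s(n)` -/
def ruleBase (j : ℕ) : Rule (ackLang j) :=
  ⟨tAck fun l => if l = last j then tVar (last j) else tZero j, tSucc (tVar (last j))⟩

open Function in
/-- `Ack(l_1,…,l_{k-2},s(m),0) → Ack(l_1,…,l_{k-2},m,s(0))` -/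
def ruleZero (j : ℕ) : Rule (ackLang j) :=
  ⟨tAck (update (update tVar (pen j) (tSucc (tVar (pen j)))) (last j) (tZero j)),
    tAck (update tVar (last j) (tSucc (tZero j)))⟩

open Function in
/-- `Ack(l_1,…,l_{k-2},s(m),s(n)) → Ack(l_1,…,l_{k-2},m,Ack(l_1,…,l_{k-2},s(m),n))` -/
def ruleSucc (j : ℕ) : Rule (ackLang j) :=
  ⟨tAck (update (update tVar (pen j) (tSucc (tVar (pen j)))) (last j) (tSucc (tVar (last j)))),
    tAck (update tVar (last j) (tAck (update tVar (pen j) (tSucc (tVar (pen j))))))⟩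

/-- `Ack(l_1,…,l_{i-1},s(l_i),0,…,0,n) → Ack(l_1,…,l_i,n,0,…,0,n)`, for `1 ≤ i ≤ k-2` -/
def ruleFront {j : ℕ} (i : Fin j) : Rule (ackLang j) :=
  ⟨tAck fun l =>
      if l < front i then tVar l
      else if l = front i then tSucc (tVar l)
      else if l = last j then tVar l
      else tZero j,
    tAck fun l =>
      if l ≤ front i then tVar l
      else if l = frontSucc i ∨ l = last j then tVar (last j)
      else tZero j⟩

/-- The TRS that encodes the Ackermann function of arity `k = j + 2`. -/
def ackTRS (j : ℕ) : TRS (ackLang j) where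
  rules := {ruleBase j, ruleZero j, ruleSucc j} ∪ Set.range ruleFront
  finite := Set.Finite.union (by simp) (Set.finite_range _)
  lhs_ne_var := by
    rintro ρ ((rfl | rfl | rfl) | ⟨i, rfl⟩) x h <;> cases h
  vars_subset := by
    rintro ρ ((rfl | rfl | rfl) | ⟨i, rfl⟩) v hv
    · rw [ruleBase, mem_vars_tSucc] at hv
      exact mem_vars_tAck.2 ⟨last j, by simpa using hv⟩
    · obtain ⟨l, hl⟩ := mem_vars_tAck.1 hv
      refine mem_vars_tAck.2 ⟨l, ?_⟩
      by_cases h1 : l = last j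
      · subst h1; simp [mem_vars_tSucc, not_mem_vars_tZero] at hl
      · by_cases h2 : l = pen j
        · subst h2; simpa [Function.update_of_ne h1, mem_vars_tSucc] using hl
        · simpa [Function.update_of_ne h1, Function.update_of_ne h2] using hl
    · obtain ⟨l, hl⟩ := mem_vars_tAck.1 hv
      have key : ∀ l, v ∈ (tVar (j := j) l).varFinset →
          v ∈ (ruleSucc j).lhs.varFinset := by
        intro l hl
        refine mem_vars_tAck.2 ⟨l, ?_⟩
        by_cases h1 : l = last j
        · subst h1; simpa [mem_vars_tSucc] using hl
        · by_cases h2 : l = pen j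
          · subst h2; simpa [Function.update_of_ne h1, mem_vars_tSucc] using hl
          · simpa [Function.update_of_ne h1, Function.update_of_ne h2] using hl
      by_cases h1 : l = last j
      · subst h1
        rw [Function.update_self] at hl
        obtain ⟨l, hl⟩ := mem_vars_tAck.1 hl
        by_cases h2 : l = pen j
        · subst h2
          rw [Function.update_self, mem_vars_tSucc] at hl
          exact key _ hl
        · rw [Function.update_of_ne h2] at hl
          exact key _ hl
      · rw [Function.update_of_ne h1] at hl
        exact key _ hl
    · obtain ⟨l, hl⟩ := mem_vars_tAck.1 hv
      have hlast : ¬ last j < front i ∧ last j ≠ front i :=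
        ⟨not_lt.2 ((front_lt_pen i).trans (pen_lt_last j)).le,
          ((front_lt_pen i).trans (pen_lt_last j)).ne'⟩
      by_cases h1 : l ≤ front i
      · refine mem_vars_tAck.2 ⟨l, ?_⟩
        rw [if_pos h1] at hl
        rcases h1.lt_or_eq with h | h
        · rwa [if_pos h]
        · rwa [if_neg h.not_lt, if_pos h, mem_vars_tSucc]
      · rw [if_neg h1] at hl
        by_cases h2 : l = frontSucc i ∨ l = last j
        · rw [if_pos h2] at hl
          refine mem_vars_tAck.2 ⟨last j, ?_⟩
          rwa [if_neg hlast.1, if_neg hlast.2, if_pos rfl]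
        · rw [if_neg h2] at hl
          exact absurd hl not_mem_vars_tZero

end DPFramework

/-! One functional hierarchy governs both `f` and the rewrite systems. If `φ` has rank `α` in the
fast-growing hierarchy, then `jump 0 p φ` has rank `α + ω^p`: for `p = 0` it iterates `φ` from `1`,
`n + 1` times, and for `p + 1` it applies the operator `jump 0 p` to `φ`, `n` times, and evaluates
at `n`. These are the recursions in the Ackermann equations, so `A_k(x_1,…,x_k)` is the function of
rank `ω^(k-2)·x_1 + … + x_(k-1)` over the successor, evaluated at `x_k` (`ackermann_eq`).

Growth: the functions `majorant p` absorb composition, iteration and all Ackermann functions, so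
each multiply recursive function is bounded by some `majorant p` of its largest argument
(`MultiplyRecursive.exists_le_majorant`). Conversely, `A_k(1,0,…,0,n)` is `jump 0 (k-2) Nat.succ n`,
which eventually dominates `majorant (k-3)` for `k ≥ 3` (`majorant_le_jump_succ`). Some derivation
from `Ack_k` on numerals has at least `A_k(x) - x_k` steps (`exists_nfold_ackermann`), while the
start term for `(1,0,…,0,n)` has size `n` plus a constant.

Termination: for `e = 1`, and with `n + 2` in place of the successor, the same construction is
strictly monotone in every argument and turns each Ackermann equation into a strict decrease. Every
rewrite step thus lowers a natural number (`realize_lt_of_step`), and this number is bounded on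
terms of bounded size.

Subterm criterion: in each dependency pair the arguments of `Ack♯` decrease lexicographically with
respect to the subterm order. Projecting to the positions one after another, from the left, removes
in each round the pairs that first differ at that position, and every position occurs. The criterion
is sound because an infinite chain projects to a sequence of rewrite and subterm steps from a
terminating term, and such sequences contain only finitely many proper steps (`acc_stepOrProper`).
-/

namespace DPFramework

/-! ### A functional form of the fast-growing hierarchy -/

/-- Strictly monotone functions that are pointwise above the identity. -/
structure Expanding (φ : ℕ → ℕ) : Prop where
  strictMono : StrictMono φ
  lt : ∀ n, n < φ n

theorem expanding_succ : Expanding Nat.succ := ⟨fun _ _ h => Nat.succ_lt_succ h, Nat.lt_succ_self⟩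

theorem Expanding.add_le_iterate {φ : ℕ → ℕ} (h : Expanding φ) (n k : ℕ) : n + k ≤ φ^[k] n := by
  induction k with
  | zero => simp
  | succ k ih =>
    rw [Function.iterate_succ_apply']
    have := h.lt (φ^[k] n)
    omega

theorem Expanding.iterate_strictMono {φ : ℕ → ℕ} (h : Expanding φ) (n : ℕ) :
    StrictMono fun k => φ^[k] n :=
  strictMono_nat_of_lt_succ fun k => by
    simp only [Function.iterate_succ_apply']
    exact h.lt _

theorem iterate_le_iterate_of_le {φ ψ : ℕ → ℕ} (hψ : Monotone ψ) (hφ : ∀ n, 1 ≤ n → 1 ≤ φ n)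
    (h : ∀ n, 1 ≤ n → φ n ≤ ψ n) (k : ℕ) {n : ℕ} (hn : 1 ≤ n) :
    1 ≤ φ^[k] n ∧ φ^[k] n ≤ ψ^[k] n := by
  induction k with
  | zero => simpa
  | succ k ih =>
    rw [Function.iterate_succ_apply', Function.iterate_succ_apply']
    exact ⟨hφ _ ih.1, (h _ ih.1).trans (hψ ih.2)⟩

/-- If `φ` is the level `α` of the fast-growing hierarchy then `jump 0 p φ` is the level
`α + ω ^ p`. The parameter `e` serves to make the inequalities between the levels strict. -/
def jump (e : ℕ) : ℕ → (ℕ → ℕ) → ℕ → ℕ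
  -- The parameter enters as a factor, not as a summand: for `e = 1` the nested Ackermann equation
  -- compares `2 * (n + 1) + 1` iterations with `2 * (n + 2)`, whereas with a summand both counts
  -- would agree.
  | 0, φ, n => φ^[(e + 1) * (n + 1)] 1
  | p + 1, φ, n => (jump e p)^[n + e] φ n

variable {e p q : ℕ} {φ ψ : ℕ → ℕ}

theorem jump_zero_apply (e : ℕ) (φ : ℕ → ℕ) (n : ℕ) : jump e 0 φ n = φ^[(e + 1) * (n + 1)] 1 := rfl

theorem apply_add_one_le_jump_zero (e : ℕ) (h : Expanding φ) (n : ℕ) :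
    φ (n + 1) ≤ jump e 0 φ n :=
  calc φ (n + 1) ≤ φ (φ^[n] 1) :=
        h.strictMono.monotone (by have := h.add_le_iterate 1 n; omega)
    _ = φ^[n + 1] 1 := (Function.iterate_succ_apply' ..).symm
    _ ≤ _ := (h.iterate_strictMono 1).monotone (by nlinarith)

theorem iterate_apply_of_forall {P : (ℕ → ℕ) → Prop} {F : (ℕ → ℕ) → ℕ → ℕ}
    (hF : ∀ φ, P φ → P (F φ)) (k : ℕ) (h : P φ) : P (F^[k] φ) := by
  induction k with
  | zero => exact h
  | succ k ih => rw [Function.iterate_succ_apply']; exact hF _ ih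

theorem monotone_iterate_of_le {P : (ℕ → ℕ) → Prop} {F : (ℕ → ℕ) → ℕ → ℕ} {n : ℕ}
    (hF : ∀ φ, P φ → P (F φ)) (hle : ∀ φ, P φ → φ n ≤ F φ n) (h : P φ) :
    Monotone fun k => F^[k] φ n :=
  monotone_nat_of_le_succ fun k => by
    simp only [Function.iterate_succ_apply']
    exact hle _ (iterate_apply_of_forall hF k h)

/-- The two claims need a joint induction: from `n` to `n + 1` both the argument and the number of
rounds grow, and the additional round does no harm only because `jump e p` does not decrease
functions. -/
theorem expanding_jump_and_le (e p : ℕ) : ∀ {φ}, Expanding φ →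
    Expanding (jump e p φ) ∧ ∀ n, 1 ≤ n → φ n ≤ jump e p φ n := by
  induction p with
  | zero =>
    refine fun {φ} h => ⟨⟨fun a b hab => ?_, fun n => ?_⟩, fun n _ => ?_⟩
    · exact h.iterate_strictMono 1 (by gcongr)
    · have := h.add_le_iterate 1 ((e + 1) * (n + 1))
      rw [jump_zero_apply]
      nlinarith
    · exact (h.strictMono.monotone n.le_succ).trans (apply_add_one_le_jump_zero e h n)
  | succ p ih =>
    intro φ h
    have hit (k) := iterate_apply_of_forall (fun φ hφ => (@ih φ hφ).1) k h
    have hm {n} (hn : 1 ≤ n) :=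
      monotone_iterate_of_le (fun φ hφ => (@ih φ hφ).1) (fun φ hφ => (@ih φ hφ).2 n hn) h
    refine ⟨⟨strictMono_nat_of_lt_succ fun n => ?_, fun n => (hit _).lt n⟩, fun n hn => ?_⟩
    · exact ((hit _).strictMono n.lt_succ_self).trans_le (hm n.succ_pos (by simp))
    · exact hm hn (Nat.zero_le (n + e))

theorem Expanding.jump (h : Expanding φ) (e p : ℕ) : Expanding (jump e p φ) :=
  (expanding_jump_and_le e p h).1

theorem Expanding.iterate_jump (h : Expanding φ) (e p k : ℕ) :
    Expanding ((DPFramework.jump e p)^[k] φ) :=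
  iterate_apply_of_forall (fun _ hφ => hφ.jump e p) k h

theorem Expanding.le_jump (h : Expanding φ) (e p : ℕ) {n : ℕ} (hn : 1 ≤ n) :
    φ n ≤ DPFramework.jump e p φ n :=
  (expanding_jump_and_le e p h).2 n hn

theorem Expanding.monotone_iterate_jump (h : Expanding φ) (e p : ℕ) {n : ℕ} (hn : 1 ≤ n) :
    Monotone fun k => (DPFramework.jump e p)^[k] φ n :=
  monotone_iterate_of_le (fun _ hφ => hφ.jump e p) (fun _ hφ => hφ.le_jump e p hn) h

/-! #### Weak monotonicity, on positive arguments -/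

theorem iterate_le_iterate_of_forall_le {F G : (ℕ → ℕ) → ℕ → ℕ}
    (hF : ∀ φ, Expanding φ → Expanding (F φ)) (hG : ∀ φ, Expanding φ → Expanding (G φ))
    (hFG : ∀ φ ψ, Expanding φ → Expanding ψ → (∀ n, 1 ≤ n → φ n ≤ ψ n) →
      ∀ n, 1 ≤ n → F φ n ≤ G ψ n)
    (hφ : Expanding φ) (hψ : Expanding ψ) (h : ∀ n, 1 ≤ n → φ n ≤ ψ n) (k : ℕ) :
    ∀ n, 1 ≤ n → F^[k] φ n ≤ G^[k] ψ n := by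
  induction k with
  | zero => exact h
  | succ k ih =>
    rw [Function.iterate_succ_apply', Function.iterate_succ_apply']
    exact hFG _ _ (iterate_apply_of_forall hF k hφ) (iterate_apply_of_forall hG k hψ) ih

theorem jump_le_jump_of_le (e p : ℕ) : ∀ φ ψ, Expanding φ → Expanding ψ →
    (∀ n, 1 ≤ n → φ n ≤ ψ n) → ∀ n, 1 ≤ n → jump e p φ n ≤ jump e p ψ n := by
  induction p with
  | zero =>
    intro φ ψ hφ hψ h n hn
    exact (iterate_le_iterate_of_le hψ.strictMono.monotone
      (fun n hn => hn.trans (hφ.lt n).le) h _ le_rfl).2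
  | succ p ih =>
    intro φ ψ hφ hψ h n hn
    exact iterate_le_iterate_of_forall_le (fun _ h => h.jump e p) (fun _ h => h.jump e p) ih
      hφ hψ h _ n hn

/-- For `n ≥ 1`, `jump e (q + 1)` runs at least one round of `jump e q`. At `0` the comparison can
fail: `jump 0 0 φ 0 = φ 1`, but `jump 0 (p + 1) φ 0 = φ 0`. This is why weak inequalities are
confined to positive arguments. -/
theorem jump_le_jump (e : ℕ) (hpq : p ≤ q) (hφ : Expanding φ) (hψ : Expanding ψ)
    (h : ∀ n, 1 ≤ n → φ n ≤ ψ n) (n : ℕ) (hn : 1 ≤ n) : jump e p φ n ≤ jump e q ψ n := by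
  refine (jump_le_jump_of_le e p φ ψ hφ hψ h n hn).trans ?_
  induction q, hpq using Nat.le_induction with
  | base => rfl
  | succ q _ ih =>
    exact ih.trans (hψ.monotone_iterate_jump e q hn (show 1 ≤ n + e by omega))

theorem iterate_jump_le_iterate_jump (e : ℕ) (hpq : p ≤ q) {k l : ℕ} (hkl : k ≤ l)
    (hφ : Expanding φ) (hψ : Expanding ψ) (h : ∀ n, 1 ≤ n → φ n ≤ ψ n) (n : ℕ) (hn : 1 ≤ n) :
    (jump e p)^[k] φ n ≤ (jump e q)^[l] ψ n :=
  (iterate_le_iterate_of_forall_le (fun _ h => h.jump e p) (fun _ h => h.jump e q)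
    (fun _ _ h₁ h₂ h => jump_le_jump e hpq h₁ h₂ h) hφ hψ h k n hn).trans
    (hψ.monotone_iterate_jump e q hn hkl)

/-! #### Strict monotonicity for `e = 1` -/

theorem iterate_lt_iterate_of_lt (hψ : StrictMono ψ) (h : ∀ n, φ n < ψ n) (k n : ℕ) :
    φ^[k + 1] n < ψ^[k + 1] n := by
  induction k with
  | zero => exact h n
  | succ k ih =>
    rw [Function.iterate_succ_apply', Function.iterate_succ_apply' ψ]
    exact (h _).trans (hψ ih)

theorem jump_one_lt_jump_one (p : ℕ) : ∀ φ ψ, Expanding φ → Expanding ψ →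
    (∀ n, φ n < ψ n) → ∀ n, jump 1 p φ n < jump 1 p ψ n := by
  induction p with
  | zero => exact fun φ ψ _ hψ h n => iterate_lt_iterate_of_lt hψ.strictMono h (2 * n + 1) 1
  | succ p ih =>
    intro φ ψ hφ hψ h n
    have key : ∀ k, ∀ n, (jump 1 p)^[k] φ n < (jump 1 p)^[k] ψ n := by
      intro k
      induction k with
      | zero => exact h
      | succ k ihk =>
        rw [Function.iterate_succ_apply', Function.iterate_succ_apply']
        exact ih _ _ (hφ.iterate_jump 1 p k) (hψ.iterate_jump 1 p k) ihk
    exact key _ n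

theorem iterate_jump_one_lt (p k : ℕ) (hφ : Expanding φ) (hψ : Expanding ψ)
    (h : ∀ n, φ n < ψ n) : ∀ n, (jump 1 p)^[k] φ n < (jump 1 p)^[k] ψ n := by
  induction k with
  | zero => exact h
  | succ k ih =>
    rw [Function.iterate_succ_apply', Function.iterate_succ_apply']
    exact jump_one_lt_jump_one p _ _ (hφ.iterate_jump 1 p k) (hψ.iterate_jump 1 p k) ih

/-- Here `e = 1` is essential: it guarantees a round even at `n = 0`, where `jump 0 (p + 1) φ`
agrees with `φ`. -/
theorem lt_jump_one (p : ℕ) : ∀ φ, Expanding φ → ∀ n, φ n < jump 1 p φ n := by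
  induction p with
  | zero =>
    exact fun φ h n => (h.strictMono n.lt_succ_self).trans_le (apply_add_one_le_jump_zero 1 h n)
  | succ p ih =>
    intro φ h n
    refine (ih φ h n).trans_le ?_
    exact monotone_iterate_of_le (fun _ h => h.jump 1 p) (fun φ h => (ih φ h n).le) h
      (show 1 ≤ n + 1 by omega)

theorem iterate_jump_one_strictMono (p : ℕ) (h : Expanding φ) (n : ℕ) :
    StrictMono fun k => (jump 1 p)^[k] φ n :=
  strictMono_nat_of_lt_succ fun k => by
    simp only [Function.iterate_succ_apply']
    exact lt_jump_one p _ (h.iterate_jump 1 p k) n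

end DPFramework

namespace DPFramework

variable {e p q : ℕ} {φ ψ : ℕ → ℕ}

/-! ### Unary majorants -/

/-- An increasing sequence of functions that is cofinal for the multiply recursive functions. -/
def majorant (p n : ℕ) : ℕ := (jump 0 p)^[p] Nat.succ (n + 1)

theorem expanding_majorant (p : ℕ) : Expanding (majorant p) where
  strictMono _ _ h := (expanding_succ.iterate_jump 0 p p).strictMono (Nat.succ_lt_succ h)
  lt n := (Nat.lt_succ_self n).trans ((expanding_succ.iterate_jump 0 p p).lt (n + 1))

theorem iterate_jump_le_majorant {k : ℕ} (hpq : p ≤ q) (hk : k ≤ q) (n : ℕ) :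
    (jump 0 p)^[k] Nat.succ (n + 1) ≤ majorant q n :=
  iterate_jump_le_iterate_jump 0 hpq hk expanding_succ expanding_succ (fun _ _ => le_rfl) _
    n.succ_pos

theorem majorant_le_majorant (hpq : p ≤ q) {m n : ℕ} (hmn : m ≤ n) :
    majorant p m ≤ majorant q n :=
  ((expanding_majorant p).strictMono.monotone hmn).trans (iterate_jump_le_majorant hpq hpq n)

theorem iterate_jump_zero_le (h : Expanding φ) (p k : ℕ) {n : ℕ} (hn : 1 ≤ n) :
    (jump 0 0)^[k] φ n ≤ (jump 0 p)^[k] φ n :=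
  iterate_jump_le_iterate_jump 0 p.zero_le le_rfl h h (fun _ _ => le_rfl) n hn

theorem iterate_jump_zero_iterate_jump_le_majorant (p k n : ℕ) :
    (jump 0 0)^[k] ((jump 0 p)^[p] Nat.succ) (n + 1) ≤ majorant (k + p) n := by
  refine (iterate_jump_zero_le (expanding_succ.iterate_jump 0 p p) p k n.succ_pos).trans ?_
  rw [← Function.iterate_add_apply]
  exact iterate_jump_le_majorant (by omega) le_rfl n

/-- Evaluation at `n + 1` keeps `majorant` on the positive arguments, where levels are comparable;
one further `jump 0 0` absorbs the shift. -/
theorem majorant_le_jump_zero (p n : ℕ) :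
    majorant p n ≤ jump 0 0 ((jump 0 p)^[p] Nat.succ) n :=
  apply_add_one_le_jump_zero 0 (expanding_succ.iterate_jump 0 p p) n

/-- Since `n ≤ φ^[n] 1`, two more applications are bounded by `n + 2` iterations from `1`, which is
one `jump 0 0` at `n + 1`; a second one removes the shift. -/
theorem Expanding.comp_le_iterate_jump_zero (h : Expanding φ) (n : ℕ) :
    φ (φ n) ≤ (DPFramework.jump 0 0)^[2] φ n :=
  calc φ (φ n) ≤ φ (φ^[n + 1] 1) := by
        rw [Function.iterate_succ_apply']
        refine h.strictMono.monotone (h.strictMono.monotone ?_)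
        have := h.add_le_iterate 1 n
        omega
    _ = φ^[n + 2] 1 := (Function.iterate_succ_apply' ..).symm
    _ = DPFramework.jump 0 0 φ (n + 1) := by rw [jump_zero_apply]; simp
    _ ≤ _ := apply_add_one_le_jump_zero 0 (h.jump 0 0) n

theorem majorant_majorant_le (p n : ℕ) : majorant p (majorant p n) ≤ majorant (p + 4) n := by
  have h := expanding_succ.iterate_jump 0 p p
  have h' := h.jump 0 0
  calc majorant p (majorant p n)
      ≤ jump 0 0 ((jump 0 p)^[p] Nat.succ) (jump 0 0 ((jump 0 p)^[p] Nat.succ) n) :=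
        (majorant_le_jump_zero p _).trans
          (h'.strictMono.monotone (majorant_le_jump_zero p n))
    _ ≤ (jump 0 0)^[2] (jump 0 0 ((jump 0 p)^[p] Nat.succ)) n := h'.comp_le_iterate_jump_zero n
    _ ≤ (jump 0 0)^[2] (jump 0 0 ((jump 0 p)^[p] Nat.succ)) (n + 1) :=
        (h'.iterate_jump 0 0 2).strictMono.monotone n.le_succ
    _ = (jump 0 0)^[3] ((jump 0 p)^[p] Nat.succ) (n + 1) := by
        rw [Function.iterate_succ_apply (jump 0 0) 2]
    _ ≤ majorant (3 + p) n := iterate_jump_zero_iterate_jump_le_majorant p 3 n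
    _ ≤ _ := majorant_le_majorant (by omega) le_rfl

theorem two_mul_le_majorant (n : ℕ) : 2 * n ≤ majorant 2 n := by
  have h1 : jump 0 0 Nat.succ = fun n => n + 2 := by
    funext n
    rw [jump_zero_apply, Nat.succ_iterate]
    omega
  have h2 (n) : (jump 0 0)^[2] Nat.succ n = 2 * n + 3 := by
    rw [Function.iterate_succ_apply, Function.iterate_one, h1, jump_zero_apply, zero_add, one_mul]
    induction n with
    | zero => rfl
    | succ n ih => rw [Function.iterate_succ_apply', ih]; omega
  have := iterate_jump_zero_le expanding_succ 2 2 n.succ_pos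
  rw [h2] at this
  exact le_trans (by omega) this

/-- The closure property behind primitive recursion. The start `n` is itself below `n` iterations
from `1`, so `2 * n + 1` iterations from `1` suffice; these are one `jump 0 0` at `2 * n`, and the
doubling is a composition with a majorant. The constant `10` is generous. -/
theorem iterate_majorant_le (p n : ℕ) :
    (majorant p)^[n + 1] n ≤ majorant (p + 10) n := by
  have hm := expanding_majorant p
  have h := expanding_succ.iterate_jump 0 p p
  have h' := h.jump 0 0
  calc (majorant p)^[n + 1] n ≤ (majorant p)^[n + 1] ((majorant p)^[n] 1) :=
        hm.strictMono.monotone.iterate _ (by have := hm.add_le_iterate 1 n; omega)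
    _ = (majorant p)^[2 * n + 1] 1 := by
        rw [← Function.iterate_add_apply, show n + 1 + n = 2 * n + 1 by omega]
    _ ≤ (jump 0 0 ((jump 0 p)^[p] Nat.succ))^[2 * n + 1] 1 :=
        (iterate_le_iterate_of_le h'.strictMono.monotone (fun n hn => hn.trans (hm.lt n).le)
          (fun n _ => majorant_le_jump_zero p n) _ le_rfl).2
    _ = (jump 0 0)^[2] ((jump 0 p)^[p] Nat.succ) (2 * n) := by
        change _ = jump 0 0 (jump 0 0 ((jump 0 p)^[p] Nat.succ)) (2 * n)
        rw [jump_zero_apply 0 (jump 0 0 _), zero_add, one_mul]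
    _ ≤ (jump 0 0)^[2] ((jump 0 p)^[p] Nat.succ) (2 * n + 1) :=
        (h.iterate_jump 0 0 2).strictMono.monotone (Nat.le_succ _)
    _ ≤ majorant (2 + p) (2 * n) := iterate_jump_zero_iterate_jump_le_majorant p 2 _
    _ ≤ majorant (p + 2) (majorant (p + 2) n) :=
        majorant_le_majorant (by omega)
          ((two_mul_le_majorant n).trans (majorant_le_majorant (by omega) le_rfl))
    _ ≤ majorant (p + 2 + 4) n := majorant_majorant_le _ _
    _ ≤ _ := majorant_le_majorant (by omega) le_rfl

theorem exists_add_le_majorant {u v : ℕ → ℕ} (hu : ∃ p, ∀ n, u n ≤ majorant p n)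
    (hv : ∃ p, ∀ n, v n ≤ majorant p n) : ∃ p, ∀ n, u n + v n ≤ majorant p n := by
  obtain ⟨a, ha⟩ := hu
  obtain ⟨b, hb⟩ := hv
  refine ⟨a + b + 2 + 4, fun n => le_trans ?_ (majorant_majorant_le _ n)⟩
  have h1 : majorant a n ≤ majorant (a + b + 2) n := majorant_le_majorant (by omega) le_rfl
  have h2 : majorant b n ≤ majorant (a + b + 2) n := majorant_le_majorant (by omega) le_rfl
  calc u n + v n ≤ 2 * majorant (a + b + 2) n := by linarith [ha n, hb n]
    _ ≤ majorant 2 (majorant (a + b + 2) n) := two_mul_le_majorant _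
    _ ≤ _ := majorant_le_majorant (by omega) le_rfl

theorem exists_comp_le_majorant {u v : ℕ → ℕ} (hu : ∃ p, ∀ n, u n ≤ majorant p n)
    (hv : ∃ p, ∀ n, v n ≤ majorant p n) : ∃ p, ∀ n, u (v n) ≤ majorant p n := by
  obtain ⟨a, ha⟩ := hu
  obtain ⟨b, hb⟩ := hv
  refine ⟨a + b + 4, fun n => le_trans ?_ (majorant_majorant_le _ n)⟩
  exact (ha _).trans (majorant_le_majorant (by omega)
    ((hb n).trans (majorant_le_majorant (by omega) le_rfl)))

theorem exists_mul_le_majorant (a : ℕ) : ∃ p, ∀ n, a * (n + 1) ≤ majorant p n := by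
  induction a with
  | zero => exact ⟨0, by simp⟩
  | succ a ih =>
    obtain ⟨p, hp⟩ := exists_add_le_majorant ih ⟨0, (expanding_majorant 0).lt⟩
    exact ⟨p, fun n => le_trans (by rw [add_mul, one_mul]) (hp n)⟩

/-- Diagonalisation: at `n` the right-hand side runs `n` rounds of `jump 0 p`, enough for the `p`
rounds of the majorant and one more for its shift. -/
theorem majorant_le_jump_succ {n : ℕ} (h : p < n) :
    majorant p n ≤ jump 0 (p + 1) Nat.succ n :=
  calc majorant p n ≤ (jump 0 0)^[1] ((jump 0 p)^[p] Nat.succ) n := majorant_le_jump_zero p n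
    _ ≤ (jump 0 p)^[1] ((jump 0 p)^[p] Nat.succ) n :=
      iterate_jump_zero_le (expanding_succ.iterate_jump 0 p p) p 1 (by omega)
    _ = (jump 0 p)^[1 + p] Nat.succ n := by rw [← Function.iterate_add_apply]
    _ ≤ _ := expanding_succ.monotone_iterate_jump 0 p (show 1 ≤ n by omega)
      (show 1 + p ≤ n + 0 by omega)

/-! ### The hierarchy on tuples of coefficients -/

/-- The function obtained from `φ` by applying `c 0` times the operator `jump e j`, then `c 1` times
the operator `jump e (j - 1)`, and so on, up to the coefficient `c (i - 1)`. -/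
def level (e j : ℕ) (φ : ℕ → ℕ) (c : ℕ → ℕ) : ℕ → ℕ → ℕ
  | 0 => φ
  | i + 1 => (jump e (j - i))^[c i] (level e j φ c i)

variable {j : ℕ} {c d : ℕ → ℕ}

theorem level_succ (e j : ℕ) (φ : ℕ → ℕ) (c : ℕ → ℕ) (i : ℕ) :
    level e j φ c (i + 1) = (jump e (j - i))^[c i] (level e j φ c i) := rfl

theorem Expanding.level (h : Expanding φ) (e j : ℕ) (c : ℕ → ℕ) (i : ℕ) :
    Expanding (level e j φ c i) := by
  induction i with
  | zero => exact h
  | succ i ih => exact ih.iterate_jump ..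

theorem level_congr {i : ℕ} (h : ∀ l < i, c l = d l) : level e j φ c i = level e j φ d i := by
  induction i with
  | zero => rfl
  | succ i ih => rw [level_succ, level_succ, h i i.lt_succ_self, ih fun l hl => h l (by omega)]

theorem level_eq_of_zero {i k : ℕ} (hik : i ≤ k) (h : ∀ l, i ≤ l → l < k → c l = 0) :
    level e j φ c k = level e j φ c i := by
  induction k, hik using Nat.le_induction with
  | base => rfl
  | succ k hk ih =>
    rw [level_succ, h k hk k.lt_succ_self, ih fun l h₁ h₂ => h l h₁ (by omega)]
    rfl

open Function in
theorem level_update_of_le {i k : ℕ} (h : k ≤ i) (m : ℕ) :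
    level e j φ (update c i m) k = level e j φ c k :=
  level_congr fun l hl => update_of_ne (by omega) _ _

open Function in
theorem level_pen {m : ℕ} (h : c j = m + 1) :
    level e j φ c (j + 1) = jump e 0 (level e j φ (update c j m) (j + 1)) := by
  rw [level_succ, level_succ, level_update_of_le le_rfl, update_self, h, iterate_succ_apply',
    Nat.sub_self]

open Function in
-- Splits off the last round at coefficient `i`. Its index `j - i` is written as a successor so that
-- the recursion of `jump` unfolds it into rounds of the next lower index, the shape that
-- `level_front_right` provides.
theorem level_front_left {i m : ℕ} (hi : i < j) (h : c i = m + 1)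
    (h0 : ∀ l, i < l → l ≤ j → c l = 0) :
    level e j φ c (j + 1) = jump e (j - (i + 1) + 1) (level e j φ (update c i m) (i + 1)) := by
  rw [level_eq_of_zero (i := i + 1) (by omega) fun l h₁ h₂ => h0 l h₁ (by omega), level_succ,
    level_succ, level_update_of_le le_rfl, update_self, h, iterate_succ_apply']
  congr 1
  omega

open Function in
theorem level_front_right {i m n : ℕ} (hi : i < j) (h0 : ∀ l, i < l → l ≤ j → c l = 0) :
    level e j φ (update (update c i m) (i + 1) n) (j + 1) =
      (jump e (j - (i + 1)))^[n] (level e j φ (update c i m) (i + 1)) := by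
  rw [level_eq_of_zero (i := i + 1 + 1) (by omega), level_succ, level_update_of_le le_rfl,
    update_self]
  intro l h₁ h₂
  rw [update_of_ne (by omega), update_of_ne (by omega), h0 l (by omega) (by omega)]

theorem level_le {N : ℕ} (h : Expanding φ) (i : ℕ) (hc : ∀ l < i, c l ≤ N) (n : ℕ) (hn : 1 ≤ n) :
    level e j φ c i n ≤ (jump e j)^[i * N] φ n := by
  induction i generalizing n with
  | zero => simp [level]
  | succ i ih =>
    rw [level_succ, add_mul, one_mul, add_comm, Function.iterate_add_apply]
    exact iterate_jump_le_iterate_jump e (Nat.sub_le j i) (hc i i.lt_succ_self)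
      (h.level e j c i) (h.iterate_jump e j _) (ih fun l hl => hc l (by omega)) n hn

/-- At coefficient `i` additional rounds make the function larger at every argument, and the later
rounds preserve strict pointwise inequalities. -/
theorem level_lt_of_lt {i : ℕ} {a b : ℕ} (h : Expanding φ) {k : ℕ} (hik : i < k) (hab : a < b)
    (n : ℕ) : level 1 j φ (Function.update c i a) k n < level 1 j φ (Function.update c i b) k n := by
  induction k, hik using Nat.le_induction generalizing n with
  | base =>
    simp only [Nat.succ_eq_add_one, level_succ, level_update_of_le le_rfl, Function.update_self]
    exact iterate_jump_one_strictMono _ (h.level ..) n hab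
  | succ k hk ih =>
    rw [level_succ, level_succ, Function.update_of_ne (by omega), Function.update_of_ne (by omega)]
    exact iterate_jump_one_lt _ _ (h.level ..) (h.level ..) ih n

end DPFramework

namespace DPFramework

open Function

variable {e j : ℕ} {φ : ℕ → ℕ}

/-! ### The hierarchy as an interpretation of `Ack` -/

/-- The coefficients that a tuple of arguments of `Ack` describes. -/
def coeff {j : ℕ} (x : Fin (j + 2) → ℕ) (l : ℕ) : ℕ := if h : l < j + 2 then x ⟨l, h⟩ else 0

theorem coeff_val (x : Fin (j + 2) → ℕ) (i : Fin (j + 2)) : coeff x i = x i := by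
  simp [coeff]

theorem coeff_update (x : Fin (j + 2) → ℕ) (i : Fin (j + 2)) (v : ℕ) :
    coeff (update x i v) = update (coeff x) i v := by
  funext l
  by_cases hl : l < j + 2
  · by_cases h : l = i
    · subst h; simp [coeff]
    · rw [update_of_ne h, coeff, coeff, dif_pos hl, dif_pos hl,
        update_of_ne (fun h' => h (congrArg Fin.val h'))]
  · rw [update_of_ne (by omega), coeff, coeff, dif_neg hl, dif_neg hl]

/-- The last argument is the argument of the function that the other ones describe. -/
def ackInterp (e : ℕ) {j : ℕ} (φ : ℕ → ℕ) (x : Fin (j + 2) → ℕ) : ℕ :=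
  level e j φ (coeff x) (j + 1) (x (last j))

theorem level_coeff_update_last (x : Fin (j + 2) → ℕ) (v : ℕ) :
    level e j φ (coeff (update x (last j) v)) (j + 1) = level e j φ (coeff x) (j + 1) := by
  rw [coeff_update]
  exact level_update_of_le (by simp) v

theorem ackInterp_update_last (x : Fin (j + 2) → ℕ) (v : ℕ) :
    ackInterp e φ (update x (last j) v) = level e j φ (coeff x) (j + 1) v := by
  rw [ackInterp, level_coeff_update_last, update_self]

theorem ackInterp_base {x : Fin (j + 2) → ℕ} (h : ∀ i, i ≠ last j → x i = 0) :
    ackInterp e φ x = φ (x (last j)) := by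
  rw [ackInterp, level_eq_of_zero (i := 0) (Nat.zero_le _)]
  · rfl
  intro l _ hl
  have := h ⟨l, by omega⟩ (by simp [Fin.ext_iff]; omega)
  rwa [← coeff_val x] at this

theorem level_coeff_pen {x : Fin (j + 2) → ℕ} {m : ℕ} (h : x (pen j) = m + 1) :
    level e j φ (coeff x) (j + 1) =
      jump e 0 (level e j φ (coeff (update x (pen j) m)) (j + 1)) := by
  rw [level_pen (m := m) (by rw [← h, ← coeff_val x]; simp), coeff_update]
  simp

/-- The function described by the arguments before `front i`, once `x (front i)` has been replaced
by `m`. -/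
theorem exists_ackInterp_front (e : ℕ) (hφ : Expanding φ) {x : Fin (j + 2) → ℕ} {i : Fin j} {m : ℕ}
    (h : x (front i) = m + 1) (h0 : ∀ l, front i < l → l < last j → x l = 0) :
    ∃ (p : ℕ) (ψ : ℕ → ℕ), Expanding ψ ∧ ackInterp e φ x = jump e (p + 1) ψ (x (last j)) ∧
      ackInterp e φ (update (update x (front i) m) (frontSucc i) (x (last j))) =
        (jump e p)^[x (last j)] ψ (x (last j)) := by
  have hc : coeff x i = m + 1 := by rw [← h, ← coeff_val x]; simp
  have hc0 : ∀ l, (i : ℕ) < l → l ≤ j → coeff x l = 0 := by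
    intro l h₁ h₂
    have := h0 ⟨l, by omega⟩ (by simpa [Fin.lt_def] using h₁)
      (by simp [Fin.lt_def]; omega)
    rwa [← coeff_val x] at this
  refine ⟨j - (i + 1), _, hφ.level e j (update (coeff x) i m) (i + 1), ?_, ?_⟩
  · rw [ackInterp, level_front_left i.2 hc hc0]
  · have hlast : last j ≠ frontSucc i := by simp [Fin.ext_iff]; omega
    have hlast' : last j ≠ front i := by simp [Fin.ext_iff]; omega
    rw [ackInterp, coeff_update, coeff_update]
    have := level_front_right (e := e) (φ := φ) (m := m) (n := x (last j)) i.2 hc0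
    simp only [Fin.val_castSucc, Fin.val_succ] at this ⊢
    rw [this, update_of_ne hlast, update_of_ne hlast']

/-- For `e = 0` the recursion of `jump` is that of the Ackermann function: raising the penultimate
argument means iterating from `1`, and raising an earlier one means using the last argument as the
next coefficient. -/
theorem isAckermann_ackInterp (j : ℕ) : IsAckermann j (ackInterp 0 Nat.succ) where
  base x h := ackInterp_base h
  zero x m hm hl := by
    rw [ackInterp_update_last, ackInterp, level_coeff_pen hm, hl]
    rfl
  succ x m n hm hn := by
    rw [ackInterp_update_last, ackInterp_update_last, ackInterp, level_coeff_pen hm, hn,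
      jump_zero_apply, jump_zero_apply, ← iterate_succ_apply' (level _ _ _ _ _)]
    congr 2
  front x i m hm h0 := by
    obtain ⟨p, ψ, -, h₁, h₂⟩ := exists_ackInterp_front 0 expanding_succ hm h0
    rw [h₁, h₂]
    rfl

theorem ackermann_eq (j : ℕ) : ackermann j = ackInterp 0 Nat.succ :=
  (existsUnique_isAckermann j).unique (isAckermann_ackermann j) (isAckermann_ackInterp j)

/-! ### Multiply recursive functions are majorised -/

theorem exists_ackermann_le_majorant (j : ℕ) :
    ∃ p, ∀ x : Fin (j + 2) → ℕ, ackermann j x ≤ majorant p (Finset.univ.sup x) := by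
  have h1 : ∃ p, ∀ n, jump 0 (j + 1) Nat.succ (n + 1) ≤ majorant p n :=
    ⟨j + 1, fun n => iterate_jump_le_majorant (p := j + 1) (k := 1) le_rfl (by omega) n⟩
  obtain ⟨p, hp⟩ := exists_comp_le_majorant h1 (exists_mul_le_majorant (j + 1))
  refine ⟨p, fun x => le_trans ?_ (hp _)⟩
  set N := Finset.univ.sup x with hN
  have hx (i) : x i ≤ N := Finset.le_sup (Finset.mem_univ i)
  have hle : N ≤ (j + 1) * (N + 1) := by nlinarith
  have hlev := expanding_succ.level 0 j (coeff x) (j + 1)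
  calc ackermann j x = level 0 j Nat.succ (coeff x) (j + 1) (x (last j)) := by
        rw [ackermann_eq, ackInterp]
    _ ≤ level 0 j Nat.succ (coeff x) (j + 1) ((j + 1) * (N + 1) + 1) :=
        hlev.strictMono.monotone ((hx _).trans (by omega))
    _ ≤ (jump 0 j)^[(j + 1) * N] Nat.succ ((j + 1) * (N + 1) + 1) := by
        refine level_le expanding_succ _ (fun l _ => ?_) _ (by omega)
        rw [coeff]
        split
        · exact hx _
        · exact Nat.zero_le _
    -- `jump 0 (j + 1)` runs as many rounds as its argument says, so the argument was raised beyond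
    -- `(j + 1) * N`; the final `+ 1` is the shift in `h1`.
    _ ≤ jump 0 (j + 1) Nat.succ ((j + 1) * (N + 1) + 1) :=
        expanding_succ.monotone_iterate_jump 0 j (by omega)
          (show (j + 1) * N ≤ (j + 1) * (N + 1) + 1 + 0 by nlinarith)

theorem sup_cons {n : ℕ} (y : ℕ) (x : Fin n → ℕ) :
    Finset.univ.sup (Fin.cons y x : Fin (n + 1) → ℕ) = max y (Finset.univ.sup x) := by
  rw [Fin.univ_succ, Finset.sup_cons, Finset.sup_map]
  simp [comp_def]

theorem MultiplyRecursive.exists_le_majorant {n : ℕ} {f : (Fin n → ℕ) → ℕ}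
    (hf : MultiplyRecursive f) : ∃ p, ∀ x, f x ≤ majorant p (Finset.univ.sup x) := by
  induction hf with
  | zero n => exact ⟨0, fun _ => Nat.zero_le _⟩
  | succ => exact ⟨0, fun x => by simpa using (expanding_majorant 0).lt (x 0)⟩
  | proj i =>
    exact ⟨0, fun x => (Finset.le_sup (Finset.mem_univ i)).trans ((expanding_majorant 0).lt _).le⟩
  | ack j => exact exists_ackermann_le_majorant j
  | comp f g _ _ ihf ihg =>
    obtain ⟨a, ha⟩ := ihf
    choose b hb using ihg
    refine ⟨max a (Finset.univ.sup b) + 4, fun x => (ha _).trans ?_⟩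
    refine le_trans ?_ (majorant_majorant_le _ _)
    refine majorant_le_majorant (le_max_left _ _) (Finset.sup_le fun i _ => (hb i x).trans ?_)
    exact majorant_le_majorant (le_max_of_le_right (Finset.le_sup (Finset.mem_univ i))) le_rfl
  | prec f g h _ _ h0 hs ihf ihg =>
    obtain ⟨a, ha⟩ := ihf
    obtain ⟨b, hb⟩ := ihg
    refine ⟨max a b + 10, fun z => ?_⟩
    have hm := expanding_majorant (max a b)
    -- With a fixed bound `N` on all inputs, the iterate from `N` dominates the counter, the
    -- parameters and the previous value at once.
    have key : ∀ (N y : ℕ) (x : Fin _ → ℕ), y ≤ N → Finset.univ.sup x ≤ N →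
        h (Fin.cons y x) ≤ (majorant (max a b))^[y + 1] N := by
      intro N y x hy hx
      induction y with
      | zero =>
        rw [h0]
        exact (ha x).trans (majorant_le_majorant (le_max_left a b) hx)
      | succ y ih =>
        rw [hs, iterate_succ_apply']
        refine (hb _).trans (majorant_le_majorant (le_max_right a b) ?_)
        have := hm.add_le_iterate N (y + 1)
        rw [sup_cons, sup_cons]
        exact max_le (by omega) (max_le (ih (by omega)) (by omega))
    rw [← Fin.cons_self_tail z]
    refine (key (Finset.univ.sup (Fin.cons (z 0) (Fin.tail z) : Fin _ → ℕ)) _ _ ?_ ?_).trans ?_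
    · rw [sup_cons]; exact le_max_left _ _
    · rw [sup_cons]; exact le_max_right _ _
    · refine le_trans ?_ (iterate_majorant_le _ _)
      refine (hm.iterate_strictMono _).monotone ?_
      rw [sup_cons]
      exact Nat.succ_le_succ (le_max_left _ _)

end DPFramework

namespace DPFramework

open Function

variable {j : ℕ}

/-! ### Derivations that compute the Ackermann function -/

/-! ### Lengths of derivations -/

section nfold

variable {α : Type} {r : α → α → Prop}

theorem nfold_trans {m n : ℕ} {a b c : α} (h₁ : nfold r m a b) (h₂ : nfold r n b c) :
    nfold r (m + n) a c := by
  induction m generalizing a with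
  | zero => cases h₁; rwa [zero_add]
  | succ m ih =>
    obtain ⟨a', h, h'⟩ := h₁
    rw [Nat.add_right_comm]
    exact ⟨a', h, ih h'⟩

theorem nfold_map {β : Type} {s : β → β → Prop} (g : α → β) (hg : ∀ a b, r a b → s (g a) (g b))
    {n : ℕ} {a b : α} (h : nfold r n a b) : nfold s n (g a) (g b) := by
  induction n generalizing a with
  | zero => cases h; rfl
  | succ n ih =>
    obtain ⟨a', h, h'⟩ := h
    exact ⟨g a', hg _ _ h, ih h'⟩

theorem nfold_add_le {w : α → ℕ} (hw : ∀ a b, r a b → w b < w a) {n : ℕ} {a b : α}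
    (h : nfold r n a b) : n + w b ≤ w a := by
  induction n generalizing a with
  | zero => cases h; omega
  | succ n ih =>
    obtain ⟨a', h, h'⟩ := h
    have := hw _ _ h
    have := ih h'
    omega

end nfold

/-! ### Instances of the Ackermann rules -/

theorem Step.update {L : FirstOrder.Language.{0, 0}} {S : Set (Rule L)} {n : ℕ}
    (f : L.Functions n) (ts : Fin n → Tm L) (i : Fin n) {t u : Tm L} (h : Step S t u) :
    Step S (.func f (update ts i t)) (.func f (update ts i u)) := by
  have := Step.arg (S := S) f (Function.update ts i t) i u (by rwa [update_self])
  rwa [update_idem] at this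

theorem subst_tZero (σ : ℕ → Tm (ackLang j)) : (tZero j).subst σ = tZero j := by
  simp only [tZero, FirstOrder.Language.Term.subst]
  congr 1
  exact Subsingleton.elim _ _

theorem subst_tSucc (t : Tm (ackLang j)) (σ : ℕ → Tm (ackLang j)) :
    (tSucc t).subst σ = tSucc (t.subst σ) := by
  simp only [tSucc, FirstOrder.Language.Term.subst]
  congr 1
  funext i
  rw [Subsingleton.elim i 0]
  rfl

theorem subst_ite (p : Prop) [Decidable p] (t u : Tm (ackLang j)) (σ : ℕ → Tm (ackLang j)) :
    (if p then t else u).subst σ = if p then t.subst σ else u.subst σ :=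
  apply_ite (fun s : Tm (ackLang j) => s.subst σ) p t u

theorem subst_tAck (ts : Fin (j + 2) → Tm (ackLang j)) (σ : ℕ → Tm (ackLang j)) :
    (tAck ts).subst σ = tAck fun i => (ts i).subst σ := rfl

/-- The substitution of the terms `y i` for the variables `tVar i`. -/
def assign (y : Fin (j + 2) → Tm (ackLang j)) (v : ℕ) : Tm (ackLang j) :=
  if h : v < j + 2 then y ⟨v, h⟩ else .var 0

theorem subst_tVar (y : Fin (j + 2) → Tm (ackLang j)) (i : Fin (j + 2)) :
    (tVar i).subst (assign y) = y i := by
  simp [tVar, FirstOrder.Language.Term.subst, assign]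

theorem subst_update (ts : Fin (j + 2) → Tm (ackLang j)) (i : Fin (j + 2)) (t : Tm (ackLang j))
    (σ : ℕ → Tm (ackLang j)) :
    (fun l => (update ts i t l).subst σ) = update (fun l => (ts l).subst σ) i (t.subst σ) :=
  Function.comp_update (fun t : Tm (ackLang j) => t.subst σ) ts i t

theorem step_base (t : Tm (ackLang j)) :
    Step (ackTRS j).rules (tAck fun l => if l = last j then t else tZero j) (tSucc t) := by
  have := Step.root (S := (ackTRS j).rules) (ruleBase j) (by simp [ackTRS]) (assign fun _ => t)
  simp only [ruleBase, subst_tAck, subst_tSucc, subst_ite,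
    subst_tVar, subst_tZero] at this
  exact this

theorem step_zero (y : Fin (j + 2) → Tm (ackLang j)) :
    Step (ackTRS j).rules (tAck (update (update y (pen j) (tSucc (y (pen j)))) (last j) (tZero j)))
      (tAck (update y (last j) (tSucc (tZero j)))) := by
  have := Step.root (S := (ackTRS j).rules) (ruleZero j) (by simp [ackTRS]) (assign y)
  simpa only [ruleZero, subst_tAck, subst_update, subst_tSucc, subst_tVar, subst_tZero] using this

theorem step_succ (y : Fin (j + 2) → Tm (ackLang j)) :
    Step (ackTRS j).rules
      (tAck (update (update y (pen j) (tSucc (y (pen j)))) (last j) (tSucc (y (last j)))))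
      (tAck (update y (last j) (tAck (update y (pen j) (tSucc (y (pen j))))))) := by
  have := Step.root (S := (ackTRS j).rules) (ruleSucc j) (by simp [ackTRS]) (assign y)
  simpa only [ruleSucc, subst_tAck, subst_update, subst_tSucc, subst_tVar] using this

theorem step_front (i : Fin j) (y : Fin (j + 2) → Tm (ackLang j)) :
    Step (ackTRS j).rules
      (tAck fun l =>
        if l < front i then y l
        else if l = front i then tSucc (y l)
        else if l = last j then y l
        else tZero j)
      (tAck fun l =>
        if l ≤ front i then y l
        else if l = frontSucc i ∨ l = last j then y (last j)
        else tZero j) := by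
  have := Step.root (S := (ackTRS j).rules) (ruleFront i) (by simp [ackTRS]) (assign y)
  simpa only [ruleFront, subst_tAck, subst_ite,
    subst_tSucc, subst_tVar, subst_tZero] using this

/-- The numeral of `n`. -/
def numeral (j : ℕ) : ℕ → Tm (ackLang j)
  | 0 => tZero j
  | n + 1 => tSucc (numeral j n)

theorem numeral_succ (n : ℕ) : numeral j (n + 1) = tSucc (numeral j n) := rfl

theorem numeral_update (x : Fin (j + 2) → ℕ) (i : Fin (j + 2)) (n : ℕ) :
    (fun l => numeral j (update x i n l)) = update (fun l => numeral j (x l)) i (numeral j n) :=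
  Function.comp_update (numeral j) x i n

/-- The length bound is relative to the last argument so that it telescopes: in the nested equation
the value of the inner call is the last argument of the outer one. The rule application itself pays
for the increments by one. -/
theorem exists_nfold_ackermann (x : Fin (j + 2) → ℕ) :
    ∃ n, nfold (Step (ackTRS j).rules) n (tAck fun i => numeral j (x i)) (numeral j (ackermann j x)) ∧
      ackermann j x ≤ n + x (last j) := by
  have hA := isAckermann_ackermann j
  have hne : pen j ≠ last j := (pen_lt_last j).ne
  induction x using (wellFounded_lexLT j).induction with
  | _ x ih =>
    rcases ackermann_cases x with h | ⟨m, hm⟩ | ⟨i, m, hm, h0⟩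
    · refine ⟨1, ⟨_, ?_, rfl⟩, by rw [hA.base x h]; omega⟩
      rw [hA.base x h]
      rw [numeral_succ]
      convert step_base (numeral j (x (last j))) using 2
      funext l
      split_ifs with hl
      · rw [hl]
      · rw [h l hl]; rfl
    · have hx : (fun l => numeral j (x l)) = update (update (fun l => numeral j (update x (pen j) m l))
          (pen j) (tSucc (numeral j (update x (pen j) m (pen j))))) (last j)
            (numeral j (x (last j))) := by
        rw [numeral_update, update_idem, update_self, ← numeral_succ, ← hm]
        simp
      rcases hl : x (last j) with _ | n
      · obtain ⟨k, hk, hk'⟩ := ih _ (lexLT_update_pen hm 1)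
        rw [← hA.zero x m hm hl] at hk hk'
        rw [update_self] at hk'
        refine ⟨k + 1, ⟨_, ?_, hk⟩, by omega⟩
        rw [hx, hl, numeral_update _ (last j)]
        exact step_zero _
      · obtain ⟨k₁, hk₁, hk₁'⟩ := ih _ (lexLT_update_last hl)
        obtain ⟨k₂, hk₂, hk₂'⟩ := ih _ (lexLT_update_pen hm (ackermann j (update x (last j) n)))
        rw [← hA.succ x m n hm hl] at hk₂ hk₂'
        rw [update_self] at hk₁' hk₂'
        -- One root step, then the inner call is evaluated below the outer `Ack`, then the outer
        -- call.
        refine ⟨(k₁ + k₂) + 1, ⟨tAck (update (fun l => numeral j (update x (pen j) m l)) (last j)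
          (tAck fun l => numeral j (update x (last j) n l))), ?_, nfold_trans ?_ hk₂⟩, by omega⟩
        · have := step_succ (j := j) fun l => numeral j (update (update x (pen j) m) (last j) n l)
          convert this using 2
          · funext l
            by_cases h₁ : l = last j
            · subst h₁; simp [hl, numeral_succ]
            · by_cases h₂ : l = pen j
              · subst h₂; simp [hm, hne, numeral_succ]
              · simp [h₁, h₂]
          · rw [numeral_update (update x (pen j) m) (last j) n, update_idem]
            congr 2
            funext l
            by_cases h₁ : l = last j
            · subst h₁; simp [hne.symm]
            · by_cases h₂ : l = pen j
              · subst h₂; simp [hm, hne, numeral_succ]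
              · simp [h₁, h₂]
        · rw [numeral_update (update x (pen j) m) (last j)]
          exact nfold_map (s := Step (ackTRS j).rules)
            (fun t => tAck (update (fun l => numeral j (update x (pen j) m l)) (last j) t))
            (fun _ _ h => h.update (L := ackLang j) _ _ _) hk₁
    · obtain ⟨k, hk, hk'⟩ := ih _ (lexLT_update_front hm (x (last j)))
      rw [← hA.front x i m hm h0] at hk hk'
      have h1 : last j ≠ frontSucc i := by simp [Fin.ext_iff]; omega
      have h2 : last j ≠ front i := by simp [Fin.ext_iff]; omega
      rw [update_of_ne h1, update_of_ne h2] at hk'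
      refine ⟨k + 1, ⟨_, ?_, hk⟩, by omega⟩
      have hlt := front_lt_frontSucc i
      convert step_front i fun l => numeral j (update x (front i) m l) using 2
      · funext l
        split_ifs with h₁ h₂ h₃
        · rw [update_of_ne h₁.ne]
        · rw [h₂, update_self, hm]; rfl
        · rw [update_of_ne h₂]
        · rw [h0 l (by omega) (lt_of_le_of_ne (Fin.le_last l) ‹_›)]; rfl
      · funext l
        split_ifs with h₁ h₂
        · rw [update_of_ne (by omega)]
        · rcases h₂ with rfl | rfl
          · rw [update_self, update_of_ne h2]
          · rw [update_of_ne h1]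
        · rw [not_or] at h₂
          rw [update_of_ne h₂.1, update_of_ne (by omega),
            h0 l (by omega) (lt_of_le_of_ne (Fin.le_last l) h₂.2)]
          rfl

theorem size_numeral (n : ℕ) : size (numeral j n) = n + 1 := by
  induction n with
  | zero => simp [numeral, tZero, size]
  | succ n ih => simp [numeral, tSucc, size, ih]; omega

theorem size_tAck (ts : Fin (j + 2) → Tm (ackLang j)) : size (tAck ts) = 1 + ∑ i, size (ts i) := by
  simp [tAck, size]

theorem le_derivationalComplexity {L : FirstOrder.Language.{0, 0}} {R : TRS L} {s t : Tm L}
    {k n : ℕ} (hs : size s ≤ n) (h : nfold (Step R.rules) k s t) :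
    (k : ℕ∞) ≤ R.derivationalComplexity n :=
  le_iSup₂_of_le s hs (le_iSup₂_of_le (f := fun (k : ℕ) _ => (k : ℕ∞)) k ⟨t, h⟩ le_rfl)

theorem ackermann_le_derivationalComplexity (x : Fin (j + 2) → ℕ) {n : ℕ}
    (hn : ∑ i, x i + j + 3 ≤ n) :
    (ackermann j x : ℕ∞) ≤ (ackTRS j).derivationalComplexity n + x (last j) := by
  obtain ⟨k, hk, hk'⟩ := exists_nfold_ackermann x
  have hs : size (tAck fun i => numeral j (x i)) ≤ n := by
    rw [size_tAck]
    simp only [size_numeral, Finset.sum_add_distrib]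
    simp
    omega
  calc (ackermann j x : ℕ∞) ≤ ((k + x (last j) : ℕ) : ℕ∞) := by exact_mod_cast hk'
    _ = k + x (last j) := by push_cast; rfl
    _ ≤ _ := by gcongr; exact le_derivationalComplexity hs hk

theorem majorises_derivationalComplexity {m : ℕ} {f : (Fin m → ℕ) → ℕ}
    (hf : MultiplyRecursive f) :
    ∃ j, Majorises (ackTRS j).derivationalComplexity f := by
  obtain ⟨p, hp⟩ := hf.exists_le_majorant
  -- The summand `n + 1` pays for strictness and for the last argument lost in the length bound.
  have hid : ∃ p, ∀ n, n + 1 ≤ majorant p n := ⟨0, (expanding_majorant 0).lt⟩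
  obtain ⟨q, hq⟩ := exists_add_le_majorant hid
    (exists_comp_le_majorant (u := majorant p) ⟨p, fun _ => le_rfl⟩ (v := fun n => 2 * n) ⟨2, two_mul_le_majorant⟩)
  -- The start term with arguments `(1,0,…,0,n)` has size `n + (q + 5)`. Choosing `n` to make this
  -- `N`, the threshold gives `N ≤ 2 * n` and `q < n`.
  refine ⟨q + 1, 2 * (q + 5), fun x hx => ?_⟩
  set N := Finset.univ.sup x with hN
  obtain ⟨n, hn⟩ : ∃ n, N = n + (q + 5) := ⟨N - (q + 5), by omega⟩
  let y : Fin (q + 1 + 2) → ℕ := update (Pi.single 0 1) (last (q + 1)) n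
  have hy0 : y 0 = 1 := by
    simp only [y]
    rw [update_of_ne (by simp [Fin.ext_iff])]
    simp
  have hyl : y (last (q + 1)) = n := update_self ..
  have hy (i) (h0 : i ≠ 0) (hl : i ≠ last (q + 1)) : y i = 0 := by
    simp only [y]
    rw [update_of_ne hl, Pi.single_eq_of_ne h0]
  have hA : ackermann (q + 1) y = jump 0 (q + 1) Nat.succ n := by
    rw [ackermann_eq, ackInterp, hyl, level_eq_of_zero (i := 1) (by omega), level_succ, Nat.sub_zero,
      show coeff y 0 = 1 from (coeff_val y 0).trans hy0]
    · rfl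
    · intro l h₁ h₂
      exact (coeff_val y ⟨l, by omega⟩).trans
        (hy _ (by simp [Fin.ext_iff]; omega) (by simp [Fin.ext_iff]; omega))
  have hsum : ∑ i, y i = n + 1 := by
    rw [Fin.sum_univ_castSucc, Fin.sum_univ_succ, Finset.sum_eq_zero, add_zero, Fin.castSucc_zero,
      hy0, hyl, add_comm]
    exact fun i _ => hy _ (by simp) (by simp [Fin.ext_iff]; omega)
  have h1 := ackermann_le_derivationalComplexity y (n := N) (by omega)
  rw [hA, hyl] at h1
  have h2 : f x + n + 1 ≤ jump 0 (q + 1) Nat.succ n := by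
    have h3 := majorant_le_jump_succ (p := q) (n := n) (by omega)
    have h4 : f x ≤ majorant p N := hp x
    have h6 : n + 1 + majorant p (2 * n) ≤ majorant q n := hq n
    have h5 : majorant p N ≤ majorant p (2 * n) := majorant_le_majorant le_rfl (by omega)
    omega
  have h7 : ((f x + 1 + n : ℕ) : ℕ∞) ≤ (ackTRS (q + 1)).derivationalComplexity N + n :=
    le_trans (by exact_mod_cast (by omega)) h1
  rw [Nat.cast_add] at h7
  have h8 := (ENat.add_le_add_iff_right (ENat.natCast_ne_top n)).1 h7
  exact lt_of_lt_of_le (by exact_mod_cast Nat.lt_succ_self _) h8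

end DPFramework

namespace DPFramework

open Function

variable {j : ℕ}

/-! ### A strictly monotone interpretation in the natural numbers -/

theorem expanding_add_two : Expanding (· + 2) :=
  ⟨fun _ _ h => Nat.add_lt_add_right h 2, fun n => by omega⟩

/-- The interpretation of `Ack` along which all rules decrease. -/
def ackWeight (x : Fin (j + 2) → ℕ) : ℕ := ackInterp 1 (· + 2) x

/-- Strictness in every argument carries the decrease of the rules through contexts. -/
theorem ackWeight_update_lt (x : Fin (j + 2) → ℕ) (i : Fin (j + 2)) {a b : ℕ} (h : a < b) :
    ackWeight (update x i a) < ackWeight (update x i b) := by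
  by_cases hi : i = last j
  · subst hi
    rw [ackWeight, ackWeight, ackInterp_update_last, ackInterp_update_last]
    exact (expanding_add_two.level ..).strictMono h
  · have hi' : (i : ℕ) < j + 1 := by
      have h₁ := i.2
      have h₂ : (i : ℕ) ≠ j + 1 := fun h => hi (Fin.ext h)
      omega
    rw [ackWeight, ackWeight, ackInterp, ackInterp, update_of_ne (Ne.symm hi),
      update_of_ne (Ne.symm hi), coeff_update, coeff_update]
    exact level_lt_of_lt expanding_add_two hi' h _

theorem ackWeight_base {x : Fin (j + 2) → ℕ} (h : ∀ i, i ≠ last j → x i = 0) :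
    x (last j) + 1 < ackWeight x := by
  rw [ackWeight, ackInterp_base h]
  exact Nat.lt_succ_self _

theorem ackWeight_zero {x : Fin (j + 2) → ℕ} {m : ℕ} (hm : x (pen j) = m + 1)
    (hl : x (last j) = 0) : ackWeight (update (update x (pen j) m) (last j) 1) < ackWeight x := by
  rw [ackWeight, ackWeight, ackInterp_update_last, ackInterp, level_coeff_pen hm, hl]
  exact (expanding_add_two.level ..).lt _

theorem ackWeight_succ {x : Fin (j + 2) → ℕ} {m n : ℕ} (hm : x (pen j) = m + 1)
    (hn : x (last j) = n + 1) :
    ackWeight (update (update x (pen j) m) (last j) (ackWeight (update x (last j) n))) <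
      ackWeight x := by
  have h := expanding_add_two.level 1 j (coeff (update x (pen j) m)) (j + 1)
  rw [ackWeight, ackWeight, ackWeight, ackInterp_update_last, ackInterp_update_last, ackInterp,
    level_coeff_pen hm, hn, jump_zero_apply, jump_zero_apply,
    ← iterate_succ_apply' (level _ _ _ _ _)]
  exact h.iterate_strictMono 1 (by omega)

theorem ackWeight_front {x : Fin (j + 2) → ℕ} {i : Fin j} {m : ℕ} (hm : x (front i) = m + 1)
    (h0 : ∀ l, front i < l → l < last j → x l = 0) :
    ackWeight (update (update x (front i) m) (frontSucc i) (x (last j))) < ackWeight x := by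
  obtain ⟨p, ψ, hψ, h₁, h₂⟩ := exists_ackInterp_front 1 expanding_add_two hm h0
  rw [ackWeight, ackWeight, h₁, h₂]
  exact iterate_jump_one_strictMono p hψ _ (Nat.lt_succ_self _)

/-- As a first-order structure the interpretation extends to terms by `realize`, which commutes with
substitution. -/
instance ackModel (j : ℕ) : (ackLang j).Structure ℕ where
  funMap
    | AckSymbol.zero, _ => 0
    | AckSymbol.succ, x => x 0 + 1
    | AckSymbol.ack, x => ackWeight x
  RelMap r _ := nomatch r

theorem realize_tZero (v : ℕ → ℕ) : (tZero j).realize v = 0 := rfl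

theorem realize_tSucc (t : Tm (ackLang j)) (v : ℕ → ℕ) :
    (tSucc t).realize v = t.realize v + 1 := rfl

theorem realize_tAck (ts : Fin (j + 2) → Tm (ackLang j)) (v : ℕ → ℕ) :
    (tAck ts).realize v = ackWeight fun i => (ts i).realize v := rfl

theorem realize_tVar (i : Fin (j + 2)) (v : ℕ → ℕ) :
    (tVar i : Tm (ackLang j)).realize v = v i := rfl

theorem realize_update (ts : Fin (j + 2) → Tm (ackLang j)) (i : Fin (j + 2)) (t : Tm (ackLang j))
    (v : ℕ → ℕ) :
    (fun l => (update ts i t l).realize v) = update (fun l => (ts l).realize v) i (t.realize v) :=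
  Function.comp_update (fun t : Tm (ackLang j) => t.realize v) ts i t

theorem realize_ite (p : Prop) [Decidable p] (t u : Tm (ackLang j)) (v : ℕ → ℕ) :
    (if p then t else u).realize v = if p then t.realize v else u.realize v :=
  apply_ite (fun s : Tm (ackLang j) => s.realize v) p t u

theorem realize_rhs_lt_realize_lhs {ρ : Rule (ackLang j)} (hρ : ρ ∈ (ackTRS j).rules)
    (v : ℕ → ℕ) : ρ.rhs.realize v < ρ.lhs.realize v := by
  have hne : pen j ≠ last j := (pen_lt_last j).ne
  rcases hρ with (rfl | rfl | rfl) | ⟨i, rfl⟩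
  · simp only [ruleBase, realize_tAck, realize_ite, realize_tSucc, realize_tVar, realize_tZero]
    refine lt_of_eq_of_lt ?_ (ackWeight_base fun i hi => if_neg hi)
    rw [if_pos rfl]
  · simp only [ruleZero, realize_tAck, realize_update, realize_tSucc, realize_tVar, realize_tZero]
    refine lt_of_eq_of_lt ?_ (ackWeight_zero (m := v (pen j)) ?_ ?_)
    · congr 1
      funext l
      by_cases h₁ : l = last j
      · subst h₁; simp
      · by_cases h₂ : l = pen j
        · subst h₂; simp [hne]
        · simp [h₁, h₂]
    · rw [update_of_ne hne, update_self]
    · rw [update_self]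
  · simp only [ruleSucc, realize_tAck, realize_update, realize_tSucc, realize_tVar]
    refine lt_of_eq_of_lt ?_ (ackWeight_succ (m := v (pen j)) (n := v (last j)) ?_ ?_)
    · rw [update_idem]
      congr 1
      funext l
      by_cases h₁ : l = last j
      · subst h₁
        rw [update_self, update_self]
        congr 1
        funext l
        by_cases h₁ : l = last j
        · subst h₁; simp [hne.symm]
        · simp [h₁]
      · by_cases h₂ : l = pen j
        · subst h₂; simp [hne]
        · simp [h₁, h₂]
    · rw [update_of_ne hne, update_self]
    · rw [update_self]
  · have h1 : last j ≠ frontSucc i := by simp [Fin.ext_iff]; omega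
    have h2 : ¬ last j ≤ front i := by simp [Fin.le_def]
    have hlt := front_lt_frontSucc i
    simp only [ruleFront, realize_tAck, realize_ite, realize_tSucc, realize_tVar, realize_tZero]
    refine lt_of_eq_of_lt ?_ (ackWeight_front (i := i) (m := v (front i)) ?_ ?_)
    · congr 1
      funext l
      rw [if_neg (c := last j < front i) fun h => h2 h.le,
        if_neg (c := last j = front i) fun h => h2 h.le, if_pos (c := last j = last j) rfl]
      by_cases h₁ : l = frontSucc i
      · rw [h₁, update_self, if_neg hlt.not_ge, if_pos (Or.inl rfl)]
      · rw [update_of_ne h₁]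
        by_cases h₂ : l = front i
        · rw [h₂, update_self, if_pos le_rfl]
        · rw [update_of_ne h₂, if_neg h₂]
          by_cases h₃ : l < front i
          · rw [if_pos h₃.le, if_pos h₃]
          · rw [if_neg fun h => h₃ (lt_of_le_of_ne h h₂), if_neg h₃]
            by_cases h₄ : l = last j
            · subst h₄; simp
            · rw [if_neg (not_or.2 ⟨h₁, h₄⟩), if_neg h₄]
    · rw [if_neg (lt_irrefl _), if_pos rfl]
    · intro l h₁ h₂
      rw [if_neg h₁.not_gt, if_neg h₁.ne', if_neg h₂.ne]

theorem realize_lt_of_step {s t : Tm (ackLang j)} (h : Step (ackTRS j).rules s t) (v : ℕ → ℕ) :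
    t.realize v < s.realize v := by
  induction h with
  | root ρ hρ σ =>
    rw [FirstOrder.Language.Term.realize_subst, FirstOrder.Language.Term.realize_subst]
    exact realize_rhs_lt_realize_lhs hρ _
  | arg f ts i u _ ih =>
    cases f with
    | zero => exact i.elim0
    | succ =>
      rw [Subsingleton.elim i 0] at ih ⊢
      change (update ts 0 u 0).realize v + 1 < (ts 0).realize v + 1
      rw [update_self]
      omega
    | ack =>
      change ackWeight (fun l => (update ts i u l).realize v) < ackWeight fun l => (ts l).realize v
      rw [realize_update]
      simpa using ackWeight_update_lt (fun l => (ts l).realize v) i ih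

theorem terminating_ackTRS (j : ℕ) : (ackTRS j).Terminating := by
  rintro t ⟨s, -, hs⟩
  exact not_strictAnti_of_wellFoundedLT (fun i => (s i).realize fun _ => 0)
    (strictAnti_nat_of_succ_lt fun i => realize_lt_of_step (hs i) _)

/-- There are infinitely many terms of a given size, because of the variables. All variables have
value `0`, however, and the arguments of a larger term take boundedly many values by induction. -/
theorem exists_realize_le (j n : ℕ) :
    ∃ b, ∀ t : Tm (ackLang j), size t ≤ n → t.realize (fun _ => 0) ≤ b := by
  induction n with
  | zero => exact ⟨0, fun t ht => by cases t <;> simp [size] at ht⟩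
  | succ n ih =>
    obtain ⟨b, hb⟩ := ih
    refine ⟨b + 1 + (Fintype.piFinset fun _ : Fin (j + 2) => Finset.range (b + 1)).sup ackWeight,
      fun t ht => ?_⟩
    cases t with
    | var x => exact Nat.zero_le _
    | func f ts =>
      have hts (i) : (ts i).realize (fun _ => 0) ≤ b := by
        refine hb _ ?_
        have := Finset.single_le_sum (f := fun i => size (ts i)) (fun _ _ => Nat.zero_le _)
          (Finset.mem_univ i)
        rw [size] at ht
        omega
      cases f with
      | zero => exact Nat.zero_le _
      | succ =>
        change (ts 0).realize _ + 1 ≤ _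
        have := hts 0
        omega
      | ack =>
        refine le_add_left ?_
        exact Finset.le_sup (f := ackWeight)
          (Fintype.mem_piFinset.2 fun i => Finset.mem_range.2 (Nat.lt_succ_of_le (hts i)))

theorem derivationalComplexity_ackTRS_lt_top (j n : ℕ) :
    (ackTRS j).derivationalComplexity n < ⊤ := by
  obtain ⟨b, hb⟩ := exists_realize_le j n
  refine lt_of_le_of_lt (b := (b : ℕ∞)) ?_ (ENat.natCast_lt_top b)
  refine iSup₂_le fun t ht => iSup₂_le fun k ⟨u, hk⟩ => ?_
  have := nfold_add_le (w := fun t : Tm (ackLang j) => t.realize fun _ => 0)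
    (fun _ _ h => realize_lt_of_step h _) hk
  have := hb t ht
  exact_mod_cast (show k ≤ b by omega)

end DPFramework

namespace DPFramework

open Function

/-! ### Soundness of the subterm criterion -/

/-! ### Rewriting combined with the subterm relation -/

section subterm

variable {L : FirstOrder.Language.{0, 0}} {S : Set (Rule L)}

theorem Subterm.trans {s t u : Tm L} (h₁ : Subterm s t) (h₂ : Subterm t u) : Subterm s u := by
  induction h₂ with
  | refl => exact h₁
  | arg f ts i _ ih => exact .arg f ts i (ih h₁)

theorem Subterm.size_le {s t : Tm L} (h : Subterm s t) : size s ≤ size t := by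
  induction h with
  | refl => exact le_rfl
  | arg f ts i _ ih =>
    have := Finset.single_le_sum (f := fun i => size (ts i)) (fun _ _ => Nat.zero_le _)
      (Finset.mem_univ i)
    rw [size]
    omega

theorem Subterm.subst {s t : Tm L} (h : Subterm s t) (σ : ℕ → Tm L) :
    Subterm (s.subst σ) (t.subst σ) := by
  induction h with
  | refl => exact .refl _
  | arg f ts i _ ih => exact .arg f (fun i => (ts i).subst σ) i ih

theorem Subterm.properSubterm_func {n : ℕ} {f : L.Functions n} {ts : Fin n → Tm L} {i : Fin n}
    {s : Tm L} (h : Subterm s (ts i)) : ProperSubterm s (.func f ts) := by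
  refine ⟨.arg f ts i h, ?_⟩
  rintro rfl
  have h₁ := h.size_le
  have := Finset.single_le_sum (f := fun i => size (ts i)) (fun _ _ => Nat.zero_le _)
    (Finset.mem_univ i)
  rw [size] at h₁
  omega

theorem ProperSubterm.exists_arg {s t : Tm L} (h : ProperSubterm s t) :
    ∃ (n : ℕ) (f : L.Functions n) (ts : Fin n → Tm L) (i : Fin n),
      t = .func f ts ∧ Subterm s (ts i) := by
  obtain ⟨h, hne⟩ := h
  cases h with
  | refl => exact absurd rfl hne
  | arg f ts i h => exact ⟨_, f, ts, i, rfl, h⟩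

theorem ProperSubterm.size_lt {s t : Tm L} (h : ProperSubterm s t) : size s < size t := by
  obtain ⟨n, f, ts, i, rfl, h'⟩ := h.exists_arg
  have := h'.size_le
  have := Finset.single_le_sum (f := fun i => size (ts i)) (fun _ _ => Nat.zero_le _)
    (Finset.mem_univ i)
  rw [size]
  omega

theorem ProperSubterm.subst {s t : Tm L} (h : ProperSubterm s t) (σ : ℕ → Tm L) :
    ProperSubterm (s.subst σ) (t.subst σ) := by
  obtain ⟨n, f, ts, i, rfl, h'⟩ := h.exists_arg
  exact Subterm.properSubterm_func (ts := fun i => (ts i).subst σ) (h'.subst σ)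

theorem Subterm.exists_step {s t u : Tm L} (h : Subterm s t) (hs : Step S s u) :
    ∃ v, Step S t v ∧ Subterm u v := by
  induction h with
  | refl => exact ⟨u, hs, .refl u⟩
  | arg f ts i _ ih =>
    obtain ⟨v, hv, huv⟩ := ih hs
    exact ⟨_, .arg f ts i v hv, .arg f _ i (by rwa [update_self])⟩

theorem TerminatingAt.acc {t : Tm L} (h : TerminatingAt S t) :
    Acc (fun a b => Step S b a) t := by
  by_contra hacc
  obtain ⟨s, h0, hs⟩ := not_acc_iff_exists_descending_chain.1 hacc
  exact h ⟨s, h0, hs⟩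

/-- A term rewrites to, or has as a proper subterm, another one. -/
def StepOrProper (S : Set (Rule L)) (t s : Tm L) : Prop := Step S t s ∨ ProperSubterm s t

/-- A nested induction, outside along rewriting from `t` and inside on the size of the subterm `s`:
a rewrite step of `s` lifts to one of `t`, and a proper subterm of `s` is a smaller subterm of the
same `t`. -/
theorem acc_stepOrProper {t : Tm L} (h : Acc (fun a b => Step S b a) t) :
    ∀ s, Subterm s t → Acc (fun a b => StepOrProper S b a) s := by
  induction h with
  | intro t _ ih =>
    intro s
    induction hn : size s using Nat.strong_induction_on generalizing s with
    | _ n ihn =>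
      intro hs
      refine ⟨s, fun u hu => ?_⟩
      rcases hu with hu | hu
      · obtain ⟨v, hv, huv⟩ := hs.exists_step hu
        exact ih v hv u huv
      · exact ihn _ (hn ▸ hu.size_lt) u rfl (hu.1.trans hs)

end subterm

/-! ### Simple projections along chains -/

section projection

variable {L : FirstOrder.Language.{0, 0}} {R : TRS L} (π : SimpleProjection L)

/-- The application of a simple projection to the root symbol only. -/
def SimpleProjection.top : Tm (L.sum L) → Tm (L.sum L)
  | .var x => .var x
  | .func (l := n) f ts =>
    match f with
    | Sum.inl g => .func (Sum.inl g) ts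
    | Sum.inr g => if h : 0 < n then ts (π n h g) else .func (Sum.inr g) ts

theorem SimpleProjection.top_inr {n : ℕ} (g : L.Functions n) (ts : Fin n → Tm (L.sum L)) :
    π.top (.func (Sum.inr g) ts) = if h : 0 < n then ts (π n h g) else .func (Sum.inr g) ts := rfl

theorem SimpleProjection.apply_inr {n : ℕ} (g : L.Functions n) (ts : Fin n → Tm (L.sum L)) :
    π.apply (.func (Sum.inr g) ts) =
      if h : 0 < n then π.apply (ts (π n h g)) else .func (Sum.inr g) ts := by
  rw [SimpleProjection.apply]

theorem SimpleProjection.apply_plain (t : Tm L) : π.apply (plain t) = plain t := by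
  induction t with
  | var x => simp [plain, FirstOrder.Language.LHom.onTerm, SimpleProjection.apply]
  | func f ts ih =>
    change π.apply (.func (Sum.inl f) fun i => plain (ts i)) = .func (Sum.inl f) fun i => plain (ts i)
    rw [SimpleProjection.apply]
    simp only [ih]

/-- The substitution may introduce dependency pair symbols, which `apply` would project as well, so
`apply` does not commute with it. On the instantiated term only the root may be projected, hence
`top`. -/
theorem SimpleProjection.apply_sharp_subst {n : ℕ} (f : L.Functions n) (ts : Fin n → Tm L)
    (σ : ℕ → Tm (L.sum L)) :
    (π.apply (sharp (.func f ts))).subst σ = π.top ((sharp (.func f ts)).subst σ) := by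
  change (π.apply (.func (Sum.inr f) fun i => plain (ts i))).subst σ =
    π.top (.func (Sum.inr f) fun i => (plain (ts i)).subst σ)
  rw [π.apply_inr, π.top_inr]
  split_ifs with h
  · rw [π.apply_plain]
  · rfl

theorem SimpleProjection.subterm_top (t : Tm (L.sum L)) : Subterm (π.top t) t := by
  cases t with
  | var x => exact .refl _
  | func f ts =>
    rcases f with g | g
    · exact .refl _
    · rw [π.top_inr]
      split_ifs with h
      · exact .arg _ _ _ (.refl _)
      · exact .refl _

/-- No rule applies at a dependency pair symbol, since left-hand sides have their root in the left
copy of the signature. -/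
theorem step_sharp {n : ℕ} {f : L.Functions n} {ts : Fin n → Tm (L.sum L)} {t : Tm (L.sum L)}
    (h : Step R.plainRules (.func (Sum.inr f) ts) t) :
    ∃ i u, Step R.plainRules (ts i) u ∧ t = .func (Sum.inr f) (update ts i u) := by
  generalize hs : (FirstOrder.Language.Term.func (Sum.inr f) ts : Tm (L.sum L)) = s at h
  cases h with
  | root ρ hρ σ =>
    obtain ⟨ρ, hρ, rfl⟩ := hρ
    exfalso
    have hne := R.lhs_ne_var ρ hρ
    cases hl : ρ.lhs with
    | var x => exact hne x hl
    | func g ls =>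
      change _ = (plain ρ.lhs).subst σ at hs
      rw [hl] at hs
      change (FirstOrder.Language.Term.func (Sum.inr f) ts : Tm (L.sum L)) =
        .func (Sum.inl g) _ at hs
      injection hs with h₁ h₂
      subst h₁
      cases h₂
  | arg g us i u hu =>
    cases hs
    exact ⟨i, u, hu, rfl⟩

theorem reflTransGen_top {n : ℕ} {f : L.Functions n} {ts : Fin n → Tm (L.sum L)}
    {t : Tm (L.sum L)}
    (h : Relation.ReflTransGen (Step R.plainRules) (.func (Sum.inr f) ts) t) :
    Relation.ReflTransGen (Step R.plainRules) (π.top (.func (Sum.inr f) ts)) (π.top t) := by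
  have key : ∃ us, t = .func (Sum.inr f) us ∧
      ∀ i, Relation.ReflTransGen (Step R.plainRules) (ts i) (us i) := by
    induction h with
    | refl => exact ⟨ts, rfl, fun _ => .refl⟩
    | tail _ hs ih =>
      obtain ⟨us, rfl, hus⟩ := ih
      obtain ⟨i, u, hu, rfl⟩ := step_sharp hs
      refine ⟨_, rfl, fun l => ?_⟩
      by_cases hl : l = i
      · subst hl
        rw [update_self]
        exact (hus l).tail hu
      · rw [update_of_ne hl]
        exact hus l
  obtain ⟨us, rfl, hus⟩ := key
  rw [π.top_inr, π.top_inr]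
  split_ifs
  · exact hus _
  · exact h

theorem TRS.exists_of_mem_dependencyPairs {ρ : Rule (L.sum L)} (h : ρ ∈ R.dependencyPairs) :
    ∃ (m n : ℕ) (g : L.Functions m) (f : L.Functions n) (ls : Fin m → Tm L) (ts : Fin n → Tm L),
      ρ = ⟨sharp (.func g ls), sharp (.func f ts)⟩ := by
  obtain ⟨ρ, hρ, n, f, ts, -, -, -, rfl⟩ := h
  cases hl : ρ.lhs with
  | var x => exact absurd hl (R.lhs_ne_var ρ hρ x)
  | func g ls => exact ⟨_, n, g, f, ls, ts, rfl⟩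

end projection

/-- If `P` failed infinitely often, the strict steps would yield an infinite descent for the
transitive closure of `r`, which is still well-founded below an accessible point. -/
theorem exists_forall_ge_of_acc {α : Type} {r : α → α → Prop} {a : ℕ → α} {P : ℕ → Prop}
    (hacc : Acc (fun x y => r y x) (a 0))
    (hle : ∀ i, Relation.ReflTransGen r (a i) (a (i + 1)))
    (hlt : ∀ i, ¬ P (i + 1) → Relation.TransGen r (a i) (a (i + 1))) :
    ∃ N, ∀ i, N ≤ i → P i := by
  by_contra! hP
  have hpath (N i) (h : N ≤ i) : Relation.ReflTransGen r (a N) (a i) := by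
    induction i, h using Nat.le_induction with
    | base => exact .refl
    | succ i _ ih => exact ih.trans (hle i)
  have key : ∀ x, Acc (Relation.TransGen fun x y => r y x) x → ∀ N, a N ≠ x := by
    intro x hx
    induction hx with
    | intro x _ ih =>
      rintro N rfl
      obtain ⟨i, hi, hPi⟩ := hP (N + 1)
      obtain ⟨i, rfl⟩ : ∃ l, i = l + 1 := ⟨i - 1, by omega⟩
      exact ih _ (Relation.transGen_swap.2 (.trans_right (hpath N i (by omega)) (hlt i hPi)))
        (i + 1) rfl
  exact key _ hacc.transGen 0 rfl

theorem subtermCriterionProcessor_sound {L : FirstOrder.Language.{0, 0}} (π : SimpleProjection L)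
    (P' : DPProblem L → Set (Rule (L.sum L))) : (subtermCriterionProcessor π P').Sound := by
  intro p hq
  rw [subtermCriterionProcessor] at hq
  split_ifs at hq with h
  swap
  · exact hq p rfl
  rintro ⟨ρ, σ, hchain⟩
  refine absurd (hq _ rfl) (not_not_intro ?_)
  have hshape (i) := TRS.exists_of_mem_dependencyPairs (p.pairs_subset (hchain i).1)
  have hr (i) : (π.apply (ρ i).rhs).subst (σ i) = π.top ((ρ i).rhs.subst (σ i)) := by
    obtain ⟨m, n, g, f, ls, ts, e⟩ := hshape i
    rw [e]
    exact π.apply_sharp_subst f ts _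
  have hl (i) : (π.apply (ρ i).lhs).subst (σ i) = π.top ((ρ i).lhs.subst (σ i)) := by
    obtain ⟨m, n, g, f, ls, ts, e⟩ := hshape i
    rw [e]
    exact π.apply_sharp_subst g ls _
  have hrew (i) : Relation.ReflTransGen (StepOrProper p.trs.plainRules)
      ((π.apply (ρ i).rhs).subst (σ i)) ((π.apply (ρ (i + 1)).lhs).subst (σ (i + 1))) := by
    have h₃ := (hchain i).2.2
    rw [hr, hl]
    obtain ⟨m, n, g, f, ls, ts, e⟩ := hshape i
    rw [e] at h₃ ⊢
    exact Relation.ReflTransGen.mono (fun _ _ => Or.inl) _ _ (reflTransGen_top π h₃)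
  have hproper (i) (hi : ρ i ∉ P' p) :
      StepOrProper p.trs.plainRules ((π.apply (ρ i).lhs).subst (σ i))
        ((π.apply (ρ i).rhs).subst (σ i)) :=
    Or.inr ((h.2.2 _ ⟨(hchain i).1, hi⟩).subst _)
  have key : ∃ N, ∀ i, N ≤ i → ρ i ∈ P' p := by
    -- The sequence consists of projected right-hand sides, because only for these is termination
    -- given. The step to `i + 1` passes through the left-hand side of pair `i + 1`, and is strict
    -- if that pair is removed.
    refine exists_forall_ge_of_acc (P := fun i => ρ i ∈ P' p)
      (a := fun i => (π.apply (ρ i).rhs).subst (σ i))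
      (r := StepOrProper p.trs.plainRules) ?_ (fun i => (hrew i).trans ?_)
      fun i hi => .trans_right (hrew i) (.single (hproper _ hi))
    · rw [hr]
      exact acc_stepOrProper (hchain 0).2.1.acc _ (π.subterm_top _)
    · by_cases hi : ρ (i + 1) ∈ P' p
      · by_cases he : π.apply (ρ (i + 1)).rhs = π.apply (ρ (i + 1)).lhs
        · rw [he]
        · exact .single (Or.inr (ProperSubterm.subst ⟨h.2.1 _ hi, he⟩ _))
      · exact .single (hproper _ hi)
  obtain ⟨N, hN⟩ := key
  exact ⟨fun i => ρ (N + i), fun i => σ (N + i), fun i =>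
    ⟨hN _ (Nat.le_add_right N i), (hchain _).2.1, (hchain _).2.2⟩⟩

theorem TRS.ProvedBySubtermCriterion.hasBasicProofTree {L : FirstOrder.Language.{0, 0}} {R : TRS L}
    {k : ℕ} (h : R.ProvedBySubtermCriterion k) : R.HasBasicProofTree := by
  obtain ⟨p, h0, hk, hp⟩ := h
  rw [TRS.HasBasicProofTree, ← h0]
  refine Nat.decreasingInduction' (P := fun i => HasProofTree IsBasicProcessor (p i))
    (fun i hi _ ih => ?_) (Nat.zero_le k) (.leaf _ hk)
  obtain ⟨-, Φ, hΦ, hpi⟩ := hp i hi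
  obtain ⟨π, P', rfl⟩ := hΦ
  refine .node _ _ (subtermCriterionProcessor_sound π P') (Or.inr (Or.inr ⟨π, P', rfl⟩)) ?_
  rw [hpi]
  rintro q rfl
  exact ih

end DPFramework

namespace DPFramework

open Function

variable {j : ℕ}

/-! ### The dependency pairs of the Ackermann systems -/

section plain

variable {L : FirstOrder.Language.{0, 0}}

theorem Subterm.plain {s t : Tm L} (h : Subterm s t) : Subterm (plain s) (plain t) := by
  induction h with
  | refl => exact .refl _
  | arg f ts i _ ih =>
    exact Subterm.arg (L := L.sum L) (Sum.inl f) (fun i => DPFramework.plain (ts i)) i ih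

theorem ProperSubterm.plain {s t : Tm L} (h : ProperSubterm s t) :
    ProperSubterm (plain s) (plain t) := by
  obtain ⟨n, f, ts, i, rfl, h'⟩ := h.exists_arg
  exact Subterm.properSubterm_func (L := L.sum L) (f := Sum.inl f)
    (ts := fun i => DPFramework.plain (ts i)) h'.plain

end plain

theorem properSubterm_tSucc (t : Tm (ackLang j)) : ProperSubterm t (tSucc t) :=
  Subterm.properSubterm_func (ts := ![t]) (i := 0) (.refl t)

theorem not_subterm_tVar (b : Fin (j + 2) → Tm (ackLang j)) (i : Fin (j + 2)) :
    ¬ Subterm (tAck b) (tVar i) := by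
  intro h
  cases h

theorem not_subterm_tZero (b : Fin (j + 2) → Tm (ackLang j)) : ¬ Subterm (tAck b) (tZero j) := by
  intro h
  generalize ht : tAck b = t at h
  cases h with
  | refl => cases ht
  | arg f ts i => exact i.elim0

theorem subterm_tSucc_iff {b : Fin (j + 2) → Tm (ackLang j)} {t : Tm (ackLang j)} :
    Subterm (tAck b) (tSucc t) ↔ Subterm (tAck b) t := by
  refine ⟨fun h => ?_, fun h => h.trans (properSubterm_tSucc t).1⟩
  generalize ht : tAck b = u at h
  cases h with
  | refl => cases ht
  | arg f ts i h => rwa [Subsingleton.elim i 0] at h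

theorem subterm_tAck {b a : Fin (j + 2) → Tm (ackLang j)} (h : Subterm (tAck b) (tAck a)) :
    b = a ∨ ∃ i, Subterm (tAck b) (a i) := by
  generalize hb : tAck b = u at h
  cases h with
  | refl => cases hb; exact Or.inl rfl
  | arg f ts i h => exact Or.inr ⟨i, h⟩

/-- Serves to check the side condition on dependency pairs: the left-hand sides contain `Ack` only
at the root. -/
theorem not_properSubterm_tAck {b a : Fin (j + 2) → Tm (ackLang j)}
    (h : ∀ i, ¬ Subterm (tAck b) (a i)) : ¬ ProperSubterm (tAck b) (tAck a) := by
  rintro ⟨hs, hne⟩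
  rcases subterm_tAck hs with rfl | ⟨i, hi⟩
  · exact hne rfl
  · exact h i hi

theorem isDefined_ack (j : ℕ) : (ackTRS j).IsDefined (n := j + 2) AckSymbol.ack :=
  ⟨ruleBase j, by simp [ackTRS], _, rfl⟩

theorem exists_tAck_of_isDefined {n : ℕ} {f : (ackLang j).Functions n}
    (h : (ackTRS j).IsDefined f) (ts : Fin n → Tm (ackLang j)) :
    ∃ b : Fin (j + 2) → Tm (ackLang j), .func f ts = tAck b := by
  cases f with
  | zero => obtain ⟨ρ, (rfl | rfl | rfl) | ⟨i, rfl⟩, us, h⟩ := h <;> cases h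
  | succ => obtain ⟨ρ, (rfl | rfl | rfl) | ⟨i, rfl⟩, us, h⟩ := h <;> cases h
  | ack => exact ⟨ts, rfl⟩

/-- The arguments `b` decrease lexicographically, with respect to the subterm order, below the
arguments `a`, and `i` is the first position at which they differ. -/
def DecreasesAt (i : Fin (j + 2)) (b a : Fin (j + 2) → Tm (ackLang j)) : Prop :=
  (∀ l, l < i → b l = a l) ∧ ProperSubterm (b i) (a i)

theorem decreasesAt_ruleZero (j : ℕ) : DecreasesAt (pen j)
    (update tVar (last j) (tSucc (tZero j)))
    (update (update tVar (pen j) (tSucc (tVar (pen j)))) (last j) (tZero j)) := by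
  have hne : pen j ≠ last j := (pen_lt_last j).ne
  refine ⟨fun l hl => ?_, ?_⟩
  · have := (hl.trans (pen_lt_last j)).ne
    rw [update_of_ne this, update_of_ne this, update_of_ne hl.ne]
  · rw [update_of_ne hne, update_of_ne hne, update_self]
    exact properSubterm_tSucc _

theorem decreasesAt_ruleSucc_outer (t : Tm (ackLang j)) : DecreasesAt (pen j)
    (update tVar (last j) t)
    (update (update tVar (pen j) (tSucc (tVar (pen j)))) (last j) (tSucc (tVar (last j)))) := by
  have hne : pen j ≠ last j := (pen_lt_last j).ne
  refine ⟨fun l hl => ?_, ?_⟩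
  · have := (hl.trans (pen_lt_last j)).ne
    rw [update_of_ne this, update_of_ne this, update_of_ne hl.ne]
  · rw [update_of_ne hne, update_of_ne hne, update_self]
    exact properSubterm_tSucc _

theorem decreasesAt_ruleSucc_inner (j : ℕ) : DecreasesAt (last j)
    (update tVar (pen j) (tSucc (tVar (pen j))))
    (update (update tVar (pen j) (tSucc (tVar (pen j)))) (last j) (tSucc (tVar (last j)))) := by
  have hne : pen j ≠ last j := (pen_lt_last j).ne
  refine ⟨fun l hl => ?_, ?_⟩
  · rw [update_of_ne hl.ne]
  · rw [update_self, update_of_ne hne.symm]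
    exact properSubterm_tSucc _

theorem decreasesAt_ruleFront (i : Fin j) : DecreasesAt (front i)
    (fun l =>
      if l ≤ front i then tVar l
      else if l = frontSucc i ∨ l = last j then tVar (last j)
      else tZero j)
    (fun l =>
      if l < front i then tVar l
      else if l = front i then tSucc (tVar l)
      else if l = last j then tVar l
      else tZero j) := by
  refine ⟨fun l hl => ?_, ?_⟩
  · beta_reduce
    rw [if_pos hl.le, if_pos hl]
  · beta_reduce
    rw [if_pos le_rfl, if_neg (lt_irrefl _), if_pos rfl]
    exact properSubterm_tSucc _

theorem not_subterm_update {b ts : Fin (j + 2) → Tm (ackLang j)} {i : Fin (j + 2)}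
    {t : Tm (ackLang j)} (hts : ∀ l, ¬ Subterm (tAck b) (ts l)) (ht : ¬ Subterm (tAck b) t)
    (l : Fin (j + 2)) : ¬ Subterm (tAck b) (update ts i t l) := by
  by_cases h : l = i
  · subst h; rwa [update_self]
  · rw [update_of_ne h]; exact hts l

/-- Only `Ack` is defined, so pairs come from its occurrences in right-hand sides: none in the base
rule, two in the nested rule, one in each other rule. -/
theorem exists_decreasesAt_of_mem_dependencyPairs {ρ : Rule ((ackLang j).sum (ackLang j))}
    (h : ρ ∈ (ackTRS j).dependencyPairs) :
    ∃ i b a, DecreasesAt i b a ∧ ρ = ⟨sharp (tAck a), sharp (tAck b)⟩ := by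
  obtain ⟨ρ, hρ, n, f, ts, hf, hs, -, rfl⟩ := h
  obtain ⟨b, hb⟩ := exists_tAck_of_isDefined hf ts
  rw [hb] at hs ⊢
  have hvar := not_subterm_tVar b
  have hsucc (i) : ¬ Subterm (tAck b) (tSucc (tVar i)) := fun h => hvar i (subterm_tSucc_iff.1 h)
  rcases hρ with (rfl | rfl | rfl) | ⟨i, rfl⟩
  · exact absurd hs (hsucc _)
  · rcases subterm_tAck hs with rfl | ⟨i, hi⟩
    · exact ⟨_, _, _, decreasesAt_ruleZero j, rfl⟩
    · exact absurd hi (not_subterm_update hvar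
        (fun h => not_subterm_tZero b (subterm_tSucc_iff.1 h)) i)
  · rcases subterm_tAck hs with rfl | ⟨i, hi⟩
    · exact ⟨_, _, _, decreasesAt_ruleSucc_outer _, rfl⟩
    · by_cases hil : i = last j
      · subst hil
        rw [update_self] at hi
        rcases subterm_tAck hi with rfl | ⟨i, hi⟩
        · exact ⟨_, _, _, decreasesAt_ruleSucc_inner j, rfl⟩
        · exact absurd hi (not_subterm_update hvar (hsucc _) i)
      · rw [update_of_ne hil] at hi
        exact absurd hi (hvar i)
  · rcases subterm_tAck hs with rfl | ⟨l, hl⟩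
    · exact ⟨_, _, _, decreasesAt_ruleFront i, rfl⟩
    · split_ifs at hl
      · exact absurd hl (hvar _)
      · exact absurd hl (hvar _)
      · exact absurd hl (not_subterm_tZero b)

/-- Ensures that each of the `j + 2` rounds removes a pair. -/
theorem exists_mem_dependencyPairs_decreasesAt (i : Fin (j + 2)) :
    ∃ b a, DecreasesAt i b a ∧
      (⟨sharp (tAck a), sharp (tAck b)⟩ : Rule ((ackLang j).sum (ackLang j))) ∈
        (ackTRS j).dependencyPairs := by
  have hvar := not_subterm_tVar (j := j)
  have hsucc (b : Fin (j + 2) → Tm (ackLang j)) (i) : ¬ Subterm (tAck b) (tSucc (tVar i)) :=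
    fun h => hvar b i (subterm_tSucc_iff.1 h)
  induction i using Fin.lastCases with
  | last =>
    refine ⟨_, _, decreasesAt_ruleSucc_inner j, ruleSucc j, by simp [ackTRS], _, AckSymbol.ack, _,
      isDefined_ack j, ?_, not_properSubterm_tAck ?_, rfl⟩
    · refine .arg (L := ackLang j) _ _ (last j) ?_
      rw [update_self]
      exact .refl _
    · exact not_subterm_update (not_subterm_update (hvar _) (hsucc _ _)) (hsucc _ _)
  | cast i =>
    induction i using Fin.lastCases with
    | last =>
      exact ⟨_, _, decreasesAt_ruleZero j, ruleZero j, by simp [ackTRS], _, AckSymbol.ack, _,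
        isDefined_ack j, .refl _, not_properSubterm_tAck (not_subterm_update
          (not_subterm_update (hvar _) (hsucc _ _)) (not_subterm_tZero _)), rfl⟩
    | cast i =>
      refine ⟨_, _, decreasesAt_ruleFront i, ruleFront i, by simp [ackTRS], _, AckSymbol.ack, _,
        isDefined_ack j, .refl _, not_properSubterm_tAck fun l => ?_, rfl⟩
      split_ifs
      · exact hvar _ _
      · exact hsucc _ _
      · exact hvar _ _
      · exact not_subterm_tZero _

/-! ### The proof by the subterm criterion -/

/-- The simple projection to the argument at position `i`. -/
def projectAt (L : FirstOrder.Language.{0, 0}) (i : ℕ) : SimpleProjection L :=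
  -- The minimum only makes the position valid at every arity; for `i < j + 2` it is `i` at `Ack♯`.
  fun n _ _ => ⟨min i (n - 1), by omega⟩

theorem projectAt_apply_sharp (i : Fin (j + 2)) (a : Fin (j + 2) → Tm (ackLang j)) :
    (projectAt (ackLang j) i).apply (sharp (tAck a)) = plain (a i) := by
  refine (SimpleProjection.apply_inr (L := ackLang j) (projectAt (ackLang j) i) AckSymbol.ack
    fun l => plain (a l)).trans ?_
  rw [dif_pos (by omega), SimpleProjection.apply_plain]
  congr 2
  ext
  simp [projectAt]
  omega

/-- The dependency pairs that do not decrease at any position before `i`. -/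
def remainingProblem (j i : ℕ) : DPProblem (ackLang j) where
  pairs := {ρ ∈ (ackTRS j).dependencyPairs | ∀ l < i,
    ¬ ProperSubterm ((projectAt (ackLang j) l).apply ρ.rhs) ((projectAt (ackLang j) l).apply ρ.lhs)}
  trs := ackTRS j
  pairs_subset := Set.sep_subset _ _

theorem provedBySubtermCriterion_ackTRS (j : ℕ) :
    (ackTRS j).ProvedBySubtermCriterion (j + 2) := by
  refine ⟨remainingProblem j, ?_, ?_, fun i hi => ⟨⟨?_, ?_⟩, _,
    ⟨projectAt _ i, fun _ => (remainingProblem j (i + 1)).pairs, rfl⟩, ?_⟩⟩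
  · simp [remainingProblem, TRS.initialProblem]
  · refine Set.eq_empty_of_forall_notMem fun ρ hρ => ?_
    obtain ⟨i, b, a, hd, rfl⟩ := exists_decreasesAt_of_mem_dependencyPairs hρ.1
    refine hρ.2 i i.2 ?_
    rw [projectAt_apply_sharp, projectAt_apply_sharp]
    exact hd.2.plain
  · exact fun ρ hρ => ⟨hρ.1, fun l hl => hρ.2 l (by omega)⟩
  -- A pair that first differs at `i` survives all earlier rounds, as its sides agree there, and is
  -- lost in this one.
  · obtain ⟨b, a, hd, hρ⟩ := exists_mem_dependencyPairs_decreasesAt ⟨i, hi⟩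
    refine fun hsub => (hsub ⟨hρ, fun l hl => ?_⟩).2 i (Nat.lt_succ_self i) ?_
    · rw [projectAt_apply_sharp ⟨l, hl.trans hi⟩, projectAt_apply_sharp ⟨l, hl.trans hi⟩,
        hd.1 ⟨l, hl.trans hi⟩ hl]
      exact fun h => h.2 rfl
    · rw [projectAt_apply_sharp ⟨i, hi⟩, projectAt_apply_sharp ⟨i, hi⟩]
      exact hd.2.plain
  · rw [subtermCriterionProcessor, dif_pos]
    · rfl
    · refine ⟨fun ρ hρ => ⟨hρ.1, fun l hl => hρ.2 l (by omega)⟩, fun ρ hρ => ?_, fun ρ hρ => ?_⟩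
      · obtain ⟨k, b, a, hd, rfl⟩ := exists_decreasesAt_of_mem_dependencyPairs hρ.1
        -- A pair that survives round `i` first differs at a later position, so its sides agree at
        -- `i` and the weak condition holds by reflexivity.
        have hk : i < k := by
          by_contra hk
          refine hρ.2 k (by omega) ?_
          rw [projectAt_apply_sharp, projectAt_apply_sharp]
          exact hd.2.plain
        rw [projectAt_apply_sharp ⟨i, hi⟩, projectAt_apply_sharp ⟨i, hi⟩, hd.1 ⟨i, hi⟩ hk]
        exact .refl _
      · by_contra hn
        refine hρ.2 ⟨hρ.1.1, fun l hl => ?_⟩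
        rcases Nat.lt_succ_iff_lt_or_eq.1 hl with hl | rfl
        · exact hρ.1.2 l hl
        · exact hn

end DPFramework

theorem lemma3p1 (m : ℕ) (f : (Fin m → ℕ) → ℕ) (hf : DPFramework.MultiplyRecursive f) :
    ∃ j : ℕ,
      DPFramework.Majorises (DPFramework.ackTRS j).derivationalComplexity f ∧
      (∀ n, (DPFramework.ackTRS j).derivationalComplexity n < ⊤) ∧
      (DPFramework.ackTRS j).Terminating ∧
      (DPFramework.ackTRS j).HasBasicProofTree ∧
      (DPFramework.ackTRS j).ProvedBySubtermCriterion (j + 2) := by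
  obtain ⟨j, hj⟩ := DPFramework.majorises_derivationalComplexity hf
  have h := DPFramework.provedBySubtermCriterion_ackTRS j
  exact ⟨j, hj, DPFramework.derivationalComplexity_ackTRS_lt_top j,
    DPFramework.terminating_ackTRS j, h.hasBasicProofTree, h⟩
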